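/- Let $k$ be a field, let $n\ge 1$, and let $Q$ be a graded $n$-Kronecker quiver: it has two vertices $1,2$ and a set $Q_1$ of $n$ arrows, all from $1$ to $2$, each arrow $\alpha$ having an arbitrary degree $\deg\alpha\in\mathbb{Z}$. Let $\Lambda=kQ=kQ_0\oplus V$ be its graded path algebra, where $kQ_0=ke_1\oplus ke_2$ is in degree $0$ and $V=e_2\Lambda e_1$ is the graded vector space with basis $Q_1$; in matrix form, $\Lambda=\begin{pmatrix}k&0\\V&k\end{pmatrix}$. View $\Lambda$ as a dg algebra with zero differential, and for $p\in\mathbb{Z}$ let $HH^p(\Lambda)=\operatorname{Hom}_{\mathcal{D}(\Lambda^e)}(\Lambda,\Lambda[p])$ be its Hochschild cohomology, where $\mathcal{D}(\Lambda^e)$ is the derived category of dg modules over $\Lambda^e=\Lambda^{\mathrm{op}}\otimes_k\Lambda$, that is, of dg $\Lambda$-bimodules. Then, for every $p\in\mathbb{Z}$, the $k$-vector space $HH^p(\Lambda)$ is finite-dimensional, and $$\dim_k HH^p(\Lambda)=\begin{cases}\#\{(\alpha,\beta)\in Q_1\times Q_1\mid \deg\alpha-\deg\beta=0\}-1&\text{if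 }p=1,\\ \#\{(\alpha,\beta)\in Q_1\times Q_1\mid \deg\alpha-\deg\beta=-1\}+1&\text{if }p=0,\\ \#\{(\alpha,\beta)\in Q_1\times Q_1\mid \deg\alpha-\deg\beta=p-1\}&\text{if }p\ne 0,1.\end{cases}$$ -/

import Mathlib

open CategoryTheory CategoryTheory.Limits
open scoped ZeroObject

universe u

set_option linter.unusedSectionVars false

/-! ### The additive structure on a localized category

If a class of morphisms `W` in an additive category is stable under finite products and finite
coproducts, then the localized category has finite biproducts, and hence a (unique) additive
structure. The localization functor is additive. -/

namespace LocalizationAdditive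
variable {C : Type*} [Category* C] [Preadditive C] [HasFiniteProducts C]
  (W : MorphismProperty C) [W.ContainsIdentities] [W.IsStableUnderFiniteProducts]
  [W.op.IsStableUnderFiniteProducts]

theorem preservesFiniteCoproducts_Q : PreservesFiniteCoproducts W.Q := by
  have : HasFiniteBiproducts C := HasFiniteBiproducts.of_hasFiniteProducts
  have : PreservesFiniteProducts W.Q.op :=
    Localization.preservesFiniteProducts W.Q.op W.op
  refine ⟨fun n => ?_⟩
  have : PreservesLimitsOfShape (Discrete (Fin n))ᵒᵖ W.Q.op :=
    preservesLimitsOfShape_of_equiv (Discrete.opposite _).symm _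
  exact preservesColimitsOfShape_of_op _ W.Q

theorem hasZeroObject : HasZeroObject W.Localization := by
  have : HasFiniteBiproducts C := HasFiniteBiproducts.of_hasFiniteProducts
  have := preservesFiniteCoproducts_Q W
  have : HasZeroObject C := hasZeroObject_of_hasFiniteBiproducts C
  have hi : IsInitial (W.Q.obj (0 : C)) :=
    IsInitial.isInitialObj W.Q _ (isZero_zero C).isInitial
  have ht : IsTerminal (W.Q.obj (0 : C)) :=
    IsTerminal.isTerminalObj W.Q _ (isZero_zero C).isTerminal
  exact ⟨W.Q.obj 0, ⟨fun Y => ⟨⟨⟨hi.to Y⟩, fun f => hi.hom_ext _ _⟩⟩,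
    fun Y => ⟨⟨⟨ht.from Y⟩, fun f => ht.hom_ext _ _⟩⟩⟩⟩

/-- Zero morphisms of the localization: those which factor through the zero object. -/
noncomputable abbrev zeroMorphisms : HasZeroMorphisms W.Localization :=
  letI := hasZeroObject W
  HasZeroObject.zeroMorphismsOfZeroObject

theorem preservesZeroMorphisms_Q :
    letI := zeroMorphisms W
    W.Q.PreservesZeroMorphisms := by
  let := zeroMorphisms W
  have : HasFiniteBiproducts C := HasFiniteBiproducts.of_hasFiniteProducts
  have : HasZeroObject C := hasZeroObject_of_hasFiniteBiproducts C
  have ht : IsTerminal (W.Q.obj (0 : C)) :=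
    IsTerminal.isTerminalObj W.Q _ (isZero_zero C).isTerminal
  refine ⟨fun X Y => ?_⟩
  have : (0 : X ⟶ Y) = (0 : X ⟶ 0) ≫ (0 : 0 ⟶ Y) := by simp
  rw [this, W.Q.map_comp, ht.hom_ext (W.Q.map (0 : X ⟶ 0)) 0, zero_comp]

/-- The image of a binary biproduct of `C` is a binary biproduct of the localization. -/
noncomputable def biprodData (X Y : C) :
    letI := zeroMorphisms W
    BinaryBiproductData (W.Q.obj X) (W.Q.obj Y) :=
  letI := zeroMorphisms W
  haveI := preservesZeroMorphisms_Q W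
  haveI := preservesFiniteCoproducts_Q W
  haveI : HasBinaryBiproducts C := HasBinaryBiproducts.of_hasBinaryProducts
  { bicone := W.Q.mapBinaryBicone (BinaryBiproduct.bicone X Y)
    isBilimit :=
      { isLimit := mapIsLimitOfPreservesOfIsLimit W.Q _ _ (BinaryBiproduct.isLimit X Y)
        isColimit := mapIsColimitOfPreservesOfIsColimit W.Q _ _ (BinaryBiproduct.isColimit X Y) } }

theorem hasBinaryBiproducts :
    letI := zeroMorphisms W
    HasBinaryBiproducts W.Localization := by
  let := zeroMorphisms W
  exact ⟨fun X Y => ⟨⟨biprodData W ((Localization.Construction.objEquiv W).symm X)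
    ((Localization.Construction.objEquiv W).symm Y)⟩⟩⟩

theorem Q_map_biprod {X Y : C} (f g : X ⟶ Y) :
    letI := zeroMorphisms W
    letI := hasBinaryBiproducts W
    W.Q.map (f + g) = biprod.lift (𝟙 (W.Q.obj X)) (𝟙 (W.Q.obj X)) ≫
      biprod.desc (W.Q.map f) (W.Q.map g) := by
  let := zeroMorphisms W
  let := hasBinaryBiproducts W
  have : HasBinaryBiproducts C := HasBinaryBiproducts.of_hasBinaryProducts
  have h0 : ∀ A B : C, W.Q.map (0 : A ⟶ B) = 0 := (preservesZeroMorphisms_Q W).map_zero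
  let e : W.Q.obj X ⊞ W.Q.obj X ⟶ W.Q.obj (X ⊞ X) :=
    biprod.desc (W.Q.map biprod.inl) (W.Q.map biprod.inr)
  have e1 : e ≫ W.Q.map biprod.fst = biprod.fst := by
    ext <;> simp [e, ← W.Q.map_comp, h0]
  have e2 : e ≫ W.Q.map biprod.snd = biprod.snd := by
    ext <;> simp [e, ← W.Q.map_comp, h0]
  have h1 : biprod.lift (𝟙 (W.Q.obj X)) (𝟙 (W.Q.obj X)) ≫ e =
      W.Q.map (biprod.lift (𝟙 X) (𝟙 X)) := by
    apply BinaryFan.IsLimit.hom_ext (biprodData W X X).isBilimit.isLimit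
    · change _ ≫ W.Q.map biprod.fst = _ ≫ W.Q.map biprod.fst
      rw [Category.assoc, e1, ← W.Q.map_comp]
      simp
    · change _ ≫ W.Q.map biprod.snd = _ ≫ W.Q.map biprod.snd
      rw [Category.assoc, e2, ← W.Q.map_comp]
      simp
  have h2 : e ≫ W.Q.map (biprod.desc f g) = biprod.desc (W.Q.map f) (W.Q.map g) := by
    ext <;> simp [e, ← W.Q.map_comp]
  rw [← h2, ← Category.assoc, h1, ← W.Q.map_comp]
  congr 1
  simp

theorem neg_add_cancel_Q {X : W.Localization} {Y : C} (f : X ⟶ W.Q.obj Y) :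
    letI := zeroMorphisms W
    letI := hasBinaryBiproducts W
    letI := SemiadditiveOfBinaryBiproducts.addCommMonoidHomOfHasBinaryBiproducts X (W.Q.obj Y)
    f ≫ W.Q.map (-(𝟙 Y)) + f = 0 := by
  let := zeroMorphisms W
  let := hasBinaryBiproducts W
  have h := Q_map_biprod W (-(𝟙 Y)) (𝟙 Y)
  have h' := SemiadditiveOfBinaryBiproducts.comp_add f (W.Q.map (-(𝟙 Y))) (W.Q.map (𝟙 Y))
  rw [neg_add_cancel, (preservesZeroMorphisms_Q W).map_zero] at h
  rw [SemiadditiveOfBinaryBiproducts.add_eq_right_addition (W.Q.map (-(𝟙 Y))), ← h, comp_zero,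
    W.Q.map_id, Category.comp_id] at h'
  exact h'.symm

/-- The additive structure on the localization. -/
noncomputable abbrev preadditive : Preadditive W.Localization :=
  letI := zeroMorphisms W
  letI := hasBinaryBiproducts W
  { homGroup := fun X Y =>
      letI M : AddCommMonoid (X ⟶ Y) :=
        SemiadditiveOfBinaryBiproducts.addCommMonoidHomOfHasBinaryBiproducts X Y
      letI N : Neg (X ⟶ Y) :=
        ⟨fun f => f ≫ W.Q.map (-(𝟙 ((Localization.Construction.objEquiv W).symm Y)))⟩
      { M, N with
        zsmul := zsmulRec
        neg_add_cancel := fun f => by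
          exact neg_add_cancel_Q W f }
    add_comp := fun _ _ _ f g h => SemiadditiveOfBinaryBiproducts.add_comp f g h
    comp_add := fun _ _ _ f g h => SemiadditiveOfBinaryBiproducts.comp_add f g h }

theorem additive_Q :
    letI := preadditive W
    W.Q.Additive := by
  let := preadditive W
  exact ⟨fun {X Y f g} => Q_map_biprod W f g⟩
end LocalizationAdditive

/-! ### Dg algebras and dg bimodules -/

/-- A differential graded `k`-algebra: a complex of `k`-vector spaces (cohomological grading)
with a unital associative multiplication whose components are
`A^i × A^j → A^n` for `i + j = n`, satisfying the graded Leibniz rule. -/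
structure DGAlgebra (k : Type u) [Field k] where
  /-- the underlying complex -/
  cx : CochainComplex (ModuleCat.{u} k) ℤ
  /-- the multiplication `A^i × A^j → A^n`, where `i + j = n` -/
  mul : ∀ (i j n : ℤ), i + j = n → (cx.X i →ₗ[k] cx.X j →ₗ[k] cx.X n)
  /-- the unit -/
  one : cx.X 0
  one_mul : ∀ (i : ℤ) (a : cx.X i), mul 0 i i (zero_add i) one a = a
  mul_one : ∀ (i : ℤ) (a : cx.X i), mul i 0 i (add_zero i) a one = a
  mul_assoc : ∀ (i j l ij jl n : ℤ) (hij : i + j = ij) (hjl : j + l = jl)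
    (h : ij + l = n) (h' : i + jl = n) (a : cx.X i) (b : cx.X j) (c : cx.X l),
    mul ij l n h (mul i j ij hij a b) c = mul i jl n h' a (mul j l jl hjl b c)
  d_mul : ∀ (i j n i' j' n' : ℤ) (_ : i + 1 = i') (_ : j + 1 = j') (_ : n + 1 = n')
    (h : i + j = n) (h₁ : i' + j = n') (h₂ : i + j' = n')
    (a : cx.X i) (b : cx.X j),
    cx.d n n' (mul i j n h a b) =
      mul i' j n' h₁ (cx.d i i' a) b +
        i.negOnePow • mul i j' n' h₂ a (cx.d j j' b)

/-- A dg bimodule over a dg `k`-algebra `A`, on which `k` acts centrally; equivalently, a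
(right) dg module over the enveloping dg algebra `Aᵒᵖ ⊗ₖ A`, with
`m · (a ⊗ b) = (-1)^{|a||m|} a m b`. -/
structure DGBimodule {k : Type u} [Field k] (A : DGAlgebra k) where
  /-- the underlying complex -/
  cx : CochainComplex (ModuleCat.{u} k) ℤ
  /-- the left action `A^i × M^j → M^n`, where `i + j = n` -/
  lact : ∀ (i j n : ℤ), i + j = n → (A.cx.X i →ₗ[k] cx.X j →ₗ[k] cx.X n)
  /-- the right action `M^i × A^j → M^n`, where `i + j = n` -/
  ract : ∀ (i j n : ℤ), i + j = n → (cx.X i →ₗ[k] A.cx.X j →ₗ[k] cx.X n)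
  one_lact : ∀ (i : ℤ) (m : cx.X i), lact 0 i i (zero_add i) A.one m = m
  ract_one : ∀ (i : ℤ) (m : cx.X i), ract i 0 i (add_zero i) m A.one = m
  lact_assoc : ∀ (i j l ij jl n : ℤ) (hij : i + j = ij) (hjl : j + l = jl)
    (h : ij + l = n) (h' : i + jl = n) (a : A.cx.X i) (b : A.cx.X j) (m : cx.X l),
    lact ij l n h (A.mul i j ij hij a b) m = lact i jl n h' a (lact j l jl hjl b m)
  ract_assoc : ∀ (i j l ij jl n : ℤ) (hij : i + j = ij) (hjl : j + l = jl)
    (h : ij + l = n) (h' : i + jl = n) (m : cx.X i) (a : A.cx.X j) (b : A.cx.X l),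
    ract ij l n h (ract i j ij hij m a) b = ract i jl n h' m (A.mul j l jl hjl a b)
  lact_ract : ∀ (i j l ij jl n : ℤ) (hij : i + j = ij) (hjl : j + l = jl)
    (h : ij + l = n) (h' : i + jl = n) (a : A.cx.X i) (m : cx.X j) (b : A.cx.X l),
    ract ij l n h (lact i j ij hij a m) b = lact i jl n h' a (ract j l jl hjl m b)
  d_lact : ∀ (i j n i' j' n' : ℤ) (_ : i + 1 = i') (_ : j + 1 = j') (_ : n + 1 = n')
    (h : i + j = n) (h₁ : i' + j = n') (h₂ : i + j' = n')
    (a : A.cx.X i) (m : cx.X j),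
    cx.d n n' (lact i j n h a m) =
      lact i' j n' h₁ (A.cx.d i i' a) m +
        i.negOnePow • lact i j' n' h₂ a (cx.d j j' m)
  d_ract : ∀ (i j n i' j' n' : ℤ) (_ : i + 1 = i') (_ : j + 1 = j') (_ : n + 1 = n')
    (h : i + j = n) (h₁ : i' + j = n') (h₂ : i + j' = n')
    (m : cx.X i) (a : A.cx.X j),
    cx.d n n' (ract i j n h m a) =
      ract i' j n' h₁ (cx.d i i' m) a +
        i.negOnePow • ract i j' n' h₂ m (A.cx.d j j' a)

theorem map_units_smul {k M N : Type*} [Field k] [AddCommGroup M] [Module k M] [AddCommGroup N]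
    [Module k N] (f : M →ₗ[k] N) (u : ℤˣ) (x : M) : f (u • x) = u • f x := by
  rcases Int.units_eq_one_or u with rfl | rfl <;> simp

namespace DGBimodule

variable {k : Type u} [Field k] {A : DGAlgebra k}

/-- The morphisms of dg bimodules: the morphisms of complexes (of degree `0`) which are
compatible with the left and right actions. -/
def homSubmodule (M N : DGBimodule A) : Submodule k (M.cx ⟶ N.cx) where
  carrier := { f |
    (∀ (i j n : ℤ) (h : i + j = n) (a : A.cx.X i) (m : M.cx.X j),
      f.f n (M.lact i j n h a m) = N.lact i j n h a (f.f j m)) ∧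
    (∀ (i j n : ℤ) (h : i + j = n) (m : M.cx.X i) (a : A.cx.X j),
      f.f n (M.ract i j n h m a) = N.ract i j n h (f.f i m) a) }
  add_mem' := by
    rintro f g ⟨hf, hf'⟩ ⟨hg, hg'⟩
    constructor
    · intro i j n h a m
      simp [hf, hg]
    · intro i j n h m a
      simp [hf', hg']
  zero_mem' := by constructor <;> intros <;> simp
  smul_mem' := by
    rintro c f ⟨hf, hf'⟩
    constructor
    · intro i j n h a m
      simp [hf]
    · intro i j n h m a
      simp [hf']

instance : Category (DGBimodule A) where
  Hom M N := homSubmodule M N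
  id M := ⟨𝟙 M.cx, by constructor <;> intros <;> simp⟩
  comp {M N P} f g := ⟨f.1 ≫ g.1, by
    constructor
    · intro i j n h a m
      simp [f.2.1 i j n h, g.2.1 i j n h]
    · intro i j n h m a
      simp [f.2.2 i j n h, g.2.2 i j n h]⟩
  id_comp f := Subtype.ext (Category.id_comp f.1)
  comp_id f := Subtype.ext (Category.comp_id f.1)
  assoc f g h := Subtype.ext (Category.assoc f.1 g.1 h.1)

instance : Preadditive (DGBimodule A) where
  homGroup M N := inferInstanceAs (AddCommGroup (homSubmodule M N))
  add_comp _ _ _ f g h := Subtype.ext (Preadditive.add_comp _ _ _ f.1 g.1 h.1)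
  comp_add _ _ _ f g h := Subtype.ext (Preadditive.comp_add _ _ _ f.1 g.1 h.1)

instance : Linear k (DGBimodule A) where
  homModule M N := inferInstanceAs (Module k (homSubmodule M N))
  smul_comp _ _ _ r f g := Subtype.ext (Linear.smul_comp _ _ _ r f.1 g.1)
  comp_smul _ _ _ f r g := Subtype.ext (Linear.comp_smul _ _ _ f.1 r g.1)

/-- The forgetful functor from dg bimodules to complexes of vector spaces. -/
def forget (A : DGAlgebra k) : DGBimodule A ⥤ CochainComplex (ModuleCat.{u} k) ℤ where
  obj M := M.cx
  map f := f.1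

instance : (forget A).Additive where
  map_add := rfl

/-- The zero dg bimodule. -/
def zero (A : DGAlgebra k) : DGBimodule A where
  cx := 
    { X := fun _ => ModuleCat.of k PUnit
      d := fun _ _ => 0 }
  lact _ _ _ _ := 0
  ract _ _ _ _ := 0
  one_lact _ _ := rfl
  ract_one _ _ := rfl
  lact_assoc _ _ _ _ _ _ _ _ _ _ _ _ _ := rfl
  ract_assoc _ _ _ _ _ _ _ _ _ _ _ _ _ := rfl
  lact_ract _ _ _ _ _ _ _ _ _ _ _ _ _ := rfl
  d_lact _ _ _ _ _ _ _ _ _ _ _ _ _ _ := rfl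
  d_ract _ _ _ _ _ _ _ _ _ _ _ _ _ _ := rfl

/-- The direct sum of two dg bimodules. -/
def prod (M N : DGBimodule A) : DGBimodule A where
  cx :=
    { X := fun i => ModuleCat.of k (M.cx.X i × N.cx.X i)
      d := fun i j => ModuleCat.ofHom ((M.cx.d i j).hom.prodMap (N.cx.d i j).hom)
      shape := fun i j h => by
        rw [M.cx.shape i j h, N.cx.shape i j h]
        rfl
      d_comp_d' := fun i j l _ _ => by
        refine ModuleCat.hom_ext (LinearMap.ext fun x => ?_)
        exact Prod.ext (ConcreteCategory.congr_hom (M.cx.d_comp_d i j l) x.1)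
          (ConcreteCategory.congr_hom (N.cx.d_comp_d i j l) x.2) }
  lact i j n h := LinearMap.mk₂ k
    (fun a m => ((M.lact i j n h a m.1, N.lact i j n h a m.2) : M.cx.X n × N.cx.X n))
    (by intros; ext <;> simp) (by intros; ext <;> simp)
    (by intros; ext <;> simp) (by intros; ext <;> simp)
  ract i j n h := LinearMap.mk₂ k
    (fun m a => ((M.ract i j n h m.1 a, N.ract i j n h m.2 a) : M.cx.X n × N.cx.X n))
    (by intros; ext <;> simp) (by intros; ext <;> simp)
    (by intros; ext <;> simp) (by intros; ext <;> simp)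
  one_lact i m := Prod.ext (M.one_lact i m.1) (N.one_lact i m.2)
  ract_one i m := Prod.ext (M.ract_one i m.1) (N.ract_one i m.2)
  lact_assoc i j l ij jl n h₁ h₂ h₃ h₄ a b m :=
    Prod.ext (M.lact_assoc i j l ij jl n h₁ h₂ h₃ h₄ a b m.1)
      (N.lact_assoc i j l ij jl n h₁ h₂ h₃ h₄ a b m.2)
  ract_assoc i j l ij jl n h₁ h₂ h₃ h₄ m a b :=
    Prod.ext (M.ract_assoc i j l ij jl n h₁ h₂ h₃ h₄ m.1 a b)
      (N.ract_assoc i j l ij jl n h₁ h₂ h₃ h₄ m.2 a b)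
  lact_ract i j l ij jl n h₁ h₂ h₃ h₄ a m b :=
    Prod.ext (M.lact_ract i j l ij jl n h₁ h₂ h₃ h₄ a m.1 b)
      (N.lact_ract i j l ij jl n h₁ h₂ h₃ h₄ a m.2 b)
  d_lact i j n i' j' n' hi hj hn h h₁ h₂ a m :=
    Prod.ext (M.d_lact i j n i' j' n' hi hj hn h h₁ h₂ a m.1) (N.d_lact i j n i' j' n' hi hj hn h h₁ h₂ a m.2)
  d_ract i j n i' j' n' hi hj hn h h₁ h₂ m a :=
    Prod.ext (M.d_ract i j n i' j' n' hi hj hn h h₁ h₂ m.1 a) (N.d_ract i j n i' j' n' hi hj hn h h₁ h₂ m.2 a)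

theorem isZero_zero : IsZero (zero A) := by
  rw [IsZero.iff_id_eq_zero]
  apply Subtype.ext
  ext i x
  rfl

/-- The direct sum is a biproduct in the category of dg bimodules. -/
def prodBicone (M N : DGBimodule A) : BinaryBicone M N where
  pt := prod M N
  fst := ⟨{ f := fun i => ModuleCat.ofHom (LinearMap.fst k (M.cx.X i) (N.cx.X i)) },
    fun _ _ _ _ _ _ => rfl, fun _ _ _ _ _ _ => rfl⟩
  snd := ⟨{ f := fun i => ModuleCat.ofHom (LinearMap.snd k (M.cx.X i) (N.cx.X i)) },
    fun _ _ _ _ _ _ => rfl, fun _ _ _ _ _ _ => rfl⟩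
  inl := ⟨{ f := fun i => ModuleCat.ofHom (LinearMap.inl k (M.cx.X i) (N.cx.X i))
            comm' := fun i j _ => by
              ext x
              exact Prod.ext rfl (map_zero (N.cx.d i j).hom) },
    fun i j n h a m => Prod.ext rfl (map_zero (N.lact i j n h a)).symm,
    fun i j n h m a => Prod.ext rfl (LinearMap.map_zero₂ (N.ract i j n h) a).symm⟩
  inr := ⟨{ f := fun i => ModuleCat.ofHom (LinearMap.inr k (M.cx.X i) (N.cx.X i))
            comm' := fun i j _ => by
              ext x
              exact Prod.ext (map_zero (M.cx.d i j).hom) rfl },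
    fun i j n h a m => Prod.ext (map_zero (M.lact i j n h a)).symm rfl,
    fun i j n h m a => Prod.ext (LinearMap.map_zero₂ (M.ract i j n h) a).symm rfl⟩
  inl_fst := rfl
  inl_snd := rfl
  inr_fst := rfl
  inr_snd := rfl

instance : HasFiniteProducts (DGBimodule A) := by
  have : HasBinaryBiproducts (DGBimodule A) := ⟨fun M N =>
    hasBinaryBiproduct_of_total (prodBicone M N) (by
      apply Subtype.ext
      refine HomologicalComplex.hom_ext _ _ fun i =>
        ModuleCat.hom_ext (LinearMap.ext fun x => ?_)
      exact Prod.ext (add_zero (x : M.cx.X i × N.cx.X i).1)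
        (zero_add (x : M.cx.X i × N.cx.X i).2))⟩
  have : HasTerminal (DGBimodule A) := isZero_zero.isTerminal.hasTerminal
  exact hasFiniteProducts_of_has_binary_and_terminal

/-- The quasi-isomorphisms of dg bimodules. -/
def quasiIso (A : DGAlgebra k) : MorphismProperty (DGBimodule A) :=
  (HomologicalComplex.quasiIso (ModuleCat.{u} k) (ComplexShape.up ℤ)).inverseImage (forget A)

/-- The dg bimodule `A`. -/
def regular (A : DGAlgebra k) : DGBimodule A where
  cx := A.cx
  lact := A.mul
  ract := A.mul
  one_lact := A.one_mul
  ract_one := A.mul_one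
  lact_assoc := A.mul_assoc
  ract_assoc := A.mul_assoc
  lact_ract := A.mul_assoc
  d_lact := A.d_mul
  d_ract := A.d_mul

/-- The shift `M[p]` of a dg bimodule: `M[p]^j = M^{j+p}`, with differential `(-1)^p d`,
left action `(a, m) ↦ (-1)^{p|a|} a m` and unchanged right action. -/
def shift (M : DGBimodule A) (p : ℤ) : DGBimodule A where
  cx := (CochainComplex.shiftFunctor (ModuleCat.{u} k) p).obj M.cx
  lact i j n h := (p * i).negOnePow • M.lact i (j + p) (n + p) (by lia)
  ract i j n h := M.ract (i + p) j (n + p) (by lia)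
  one_lact i m := by
    rw [mul_zero, Int.negOnePow_zero, one_smul]
    exact M.one_lact (i + p) m
  ract_one i m := M.ract_one (i + p) m
  lact_assoc i j l ij jl n h₁ h₂ h₃ h₄ a b m := by
    have h := M.lact_assoc i j (l + p) ij (jl + p) (n + p) h₁ (by lia) (by lia) (by lia) a b m
    have e : (p * ij).negOnePow = (p * i).negOnePow * (p * j).negOnePow := by
      rw [← Int.negOnePow_add, ← h₁, mul_add]
    change (p * ij).negOnePow • M.lact ij (l + p) (n + p) _ (A.mul i j ij h₁ a b) m =
      (p * i).negOnePow • M.lact i (jl + p) (n + p) _ a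
        ((p * j).negOnePow • M.lact j (l + p) (jl + p) _ b m)
    rw [h, map_units_smul, smul_smul, e]
  ract_assoc i j l ij jl n h₁ h₂ h₃ h₄ m a b := M.ract_assoc _ _ _ _ _ _ _ _ _ _ _ _ _
  lact_ract i j l ij jl n h₁ h₂ h₃ h₄ a m b := by
    have h := M.lact_ract i (j + p) l (ij + p) (jl + p) (n + p) (by lia) (by lia) (by lia)
      (by lia) a m b
    change M.ract (ij + p) l (n + p) _ ((p * i).negOnePow • M.lact i (j + p) (ij + p) _ a m) b =
      (p * i).negOnePow • M.lact i (jl + p) (n + p) _ a (M.ract (j + p) l (jl + p) _ m b)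
    rw [map_units_smul, ← h]
    rfl
  d_lact i j n i' j' n' hi hj hn h h₁ h₂ a m := by
    have hd := M.d_lact i (j + p) (n + p) i' (j' + p) (n' + p) hi (by lia) (by lia) (by lia)
      (by lia) (by lia) a m
    have e : (p * i').negOnePow = p.negOnePow * (p * i).negOnePow := by
      rw [← Int.negOnePow_add, ← hi]
      congr 1
      ring
    change p.negOnePow • M.cx.d (n + p) (n' + p)
        ((p * i).negOnePow • M.lact i (j + p) (n + p) _ a m) =
      (p * i').negOnePow • M.lact i' (j + p) (n' + p) _ (A.cx.d i i' a) m +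
      i.negOnePow • (p * i).negOnePow • M.lact i (j' + p) (n' + p) _ a
        (p.negOnePow • M.cx.d (j + p) (j' + p) m)
    erw [map_units_smul (M.cx.d (n + p) (n' + p)).hom]
    erw [hd]
    rw [map_units_smul, e, smul_add, smul_add]
    simp only [smul_smul]
    congr 2
    ac_rfl
  d_ract i j n i' j' n' hi hj hn h h₁ h₂ m a := by
    have hd := M.d_ract (i + p) j (n + p) (i' + p) j' (n' + p) (by lia) hj (by lia) (by lia)
      (by lia) (by lia) m a
    have e : i.negOnePow = p.negOnePow * (i + p).negOnePow := by
      rw [← Int.negOnePow_add, show p + (i + p) = i + 2 * p by ring, Int.negOnePow_add,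
        Int.negOnePow_two_mul, mul_one]
    change p.negOnePow • M.cx.d (n + p) (n' + p) (M.ract (i + p) j (n + p) _ m a) =
      M.ract (i' + p) j (n' + p) _ (p.negOnePow • M.cx.d (i + p) (i' + p) m) a +
      i.negOnePow • M.ract (i + p) j' (n' + p) _ m (A.cx.d j j' a)
    rw [map_units_smul, hd, smul_add, e, mul_smul]
    rfl

/-- The cohomology functors on dg bimodules. -/
noncomputable def cohomology (A : DGAlgebra k) (n : ℤ) : DGBimodule A ⥤ ModuleCat.{u} k :=
  forget A ⋙ HomologicalComplex.homologyFunctor (ModuleCat.{u} k) (ComplexShape.up ℤ) n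

instance (n : ℤ) : (cohomology A n).Additive := by
  unfold cohomology
  infer_instance

theorem quasiIso_iff {M N : DGBimodule A} (f : M ⟶ N) :
    quasiIso A f ↔ ∀ n, IsIso ((cohomology A n).map f) := by
  change QuasiIso ((forget A).map f) ↔ _
  rw [_root_.quasiIso_iff]
  exact forall_congr' fun n => quasiIsoAt_iff_isIso_homologyMap _ _

instance : (quasiIso A).ContainsIdentities :=
  ⟨fun M => (quasiIso_iff _).2 fun n => by
    rw [CategoryTheory.Functor.map_id]
    infer_instance⟩

/-- If a functor which preserves limits of shape `J` inverts all components of a morphism of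
diagrams, then it inverts the induced morphism between the limits. -/
theorem isIso_map_of_isLimit {C D J : Type*} [Category* C] [Category* D] [Category* J]
    (F : C ⥤ D) [PreservesLimitsOfShape J F] (X₁ X₂ : J ⥤ C) (c₁ : Cone X₁) (c₂ : Cone X₂)
    (h₁ : IsLimit c₁) (h₂ : IsLimit c₂) (f : X₁ ⟶ X₂) (hf : ∀ j, IsIso (F.map (f.app j)))
    (φ : c₁.pt ⟶ c₂.pt) (hφ : ∀ j, φ ≫ c₂.π.app j = c₁.π.app j ≫ f.app j) :
    IsIso (F.map φ) := by
  have : IsIso (Functor.whiskerRight f F) := by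
    rw [NatTrans.isIso_iff_isIso_app]
    exact hf
  let e := IsLimit.conePointsIsoOfNatIso (isLimitOfPreserves F h₁) (isLimitOfPreserves F h₂)
    (asIso (Functor.whiskerRight f F))
  have : F.map φ = e.hom := by
    apply (isLimitOfPreserves F h₂).hom_ext
    intro j
    have := IsLimit.conePointsIsoOfNatIso_hom_comp (isLimitOfPreserves F h₁)
      (isLimitOfPreserves F h₂) (asIso (Functor.whiskerRight f F)) j
    rw [this]
    change F.map φ ≫ F.map (c₂.π.app j) = F.map (c₁.π.app j) ≫ F.map (f.app j)
    rw [← F.map_comp, ← F.map_comp, hφ]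
  rw [this]
  infer_instance

instance : (quasiIso A).IsStableUnderFiniteProducts where
  isStableUnderProductsOfShape _ _ :=
    { condition := fun X₁ X₂ c₁ c₂ h₁ h₂ f hf φ hφ => (quasiIso_iff _).2 fun n =>
        isIso_map_of_isLimit (cohomology A n) X₁ X₂ c₁ c₂ h₁ h₂ f
          (fun j => (quasiIso_iff _).1 (hf j) n) φ hφ }

instance : (quasiIso A).op.IsStableUnderFiniteProducts where
  isStableUnderProductsOfShape _ _ :=
    { condition := fun X₁ X₂ c₁ c₂ h₁ h₂ f hf φ hφ => by
        refine (quasiIso_iff φ.unop).2 fun n => ?_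
        have : HasFiniteBiproducts (DGBimodule A) := HasFiniteBiproducts.of_hasFiniteProducts
        have : PreservesFiniteProducts (cohomology A n).op := preservesFiniteProducts_op _
        have := isIso_map_of_isLimit (cohomology A n).op X₁ X₂ c₁ c₂ h₁ h₂ f
          (fun j => by
            have := (quasiIso_iff (f.app j).unop).1 (hf j) n
            exact inferInstanceAs (IsIso ((cohomology A n).map (f.app j).unop).op)) φ hφ
        exact (isIso_op_iff _).1 this }

end DGBimodule

namespace DGAlgebra

variable {k : Type u} [Field k]

/-- The derived category of dg `A`-bimodules: the localization of the category of dg bimodules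
at the quasi-isomorphisms. -/
abbrev BimoduleDerivedCategory (A : DGAlgebra k) := (DGBimodule.quasiIso A).Localization

noncomputable instance (A : DGAlgebra k) : Preadditive A.BimoduleDerivedCategory :=
  LocalizationAdditive.preadditive (DGBimodule.quasiIso A)

instance (A : DGAlgebra k) : (DGBimodule.quasiIso A).Q.Additive :=
  LocalizationAdditive.additive_Q (DGBimodule.quasiIso A)

/-- The Hochschild cohomology `HH^p(A) = Hom(A, A[p])` of a dg algebra `A`, the morphisms being
taken in the derived category of dg `A`-bimodules. It is a `k`-vector space, with the `k`-linear
structure that the derived category inherits from the category of dg bimodules. -/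
abbrev HH (A : DGAlgebra k) (p : ℤ) : Type (u + 1) :=
  (DGBimodule.quasiIso A).Q.obj (DGBimodule.regular A) ⟶
    (DGBimodule.quasiIso A).Q.obj ((DGBimodule.regular A).shift p)

end DGAlgebra

/-! ### Graded Kronecker algebras -/

namespace Kronecker

variable (k : Type u) [Field k] {n : ℕ} (deg : Fin n → ℤ)

/-- The path algebra `Λ = k e₁ ⊕ k e₂ ⊕ V` of the `n`-Kronecker quiver, where `V` has the `n`
arrows as a basis: the element `((a, b), v)` stands for `a e₁ + b e₂ + ∑ α, v α • α`, or for the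
lower triangular matrix with diagonal entries `a` and `b`, and with lower left entry `v`. -/
abbrev PathAlgebra (n : ℕ) : Type u := (k × k) × (Fin n → k)

/-- The homogeneous part of degree `i` of the path algebra, where `e₁` and `e₂` have degree `0`
and an arrow `α` has degree `deg α`. -/
def homogeneous (i : ℤ) : Submodule k (PathAlgebra k n) where
  carrier := { x | (i ≠ 0 → x.1 = 0) ∧ ∀ α, deg α ≠ i → x.2 α = 0 }
  add_mem' := fun {x y} hx hy => by
    refine ⟨fun h => ?_, fun α h => ?_⟩
    · simp [hx.1 h, hy.1 h]
    · simp [hx.2 α h, hy.2 α h]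
  zero_mem' := ⟨fun _ => rfl, fun _ _ => rfl⟩
  smul_mem' := fun c x hx => by
    refine ⟨fun h => ?_, fun α h => ?_⟩
    · simp [hx.1 h]
    · simp [hx.2 α h]

/-- The multiplication of the path algebra, which is that of lower triangular matrices:
the arrows satisfy `e₂ α = α = α e₁`. -/
def pathMul : PathAlgebra k n →ₗ[k] PathAlgebra k n →ₗ[k] PathAlgebra k n :=
  LinearMap.mk₂ k
    (fun x y => ((x.1.1 * y.1.1, x.1.2 * y.1.2), fun α => x.2 α * y.1.1 + x.1.2 * y.2 α))
    (fun x x' y => by ext <;> simp <;> ring) (fun c x y => by ext <;> simp <;> ring)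
    (fun x y y' => by ext <;> simp <;> ring) (fun c x y => by ext <;> simp <;> ring)

theorem pathMul_mem {i j l : ℤ} (h : i + j = l) {x y : PathAlgebra k n}
    (hx : x ∈ homogeneous k deg i) (hy : y ∈ homogeneous k deg j) :
    pathMul k x y ∈ homogeneous k deg l := by
  have hij : l ≠ 0 → i ≠ 0 ∨ j ≠ 0 := by lia
  refine ⟨fun hl => ?_, fun α hα => ?_⟩
  · rcases hij hl with h' | h'
    · have := hx.1 h'
      simp [pathMul, this]
    · have := hy.1 h'
      simp [pathMul, this]
  · have h1 : x.2 α * y.1.1 = 0 := by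
      by_cases hi : deg α = i
      · rw [hy.1 (by lia)]
        simp
      · rw [hx.2 α hi, zero_mul]
    have h2 : x.1.2 * y.2 α = 0 := by
      by_cases hj : deg α = j
      · rw [hx.1 (by lia)]
        simp
      · rw [hy.2 α hj, mul_zero]
    change x.2 α * y.1.1 + x.1.2 * y.2 α = 0
    rw [h1, h2, add_zero]

/-- The graded Kronecker algebra with arrows of degrees `deg α`, as a dg algebra with zero
differential. -/
def dgAlgebra : DGAlgebra k where
  cx :=
    { X := fun i => ModuleCat.of k (homogeneous k deg i)
      d := fun _ _ => 0 }
  mul i j l h := LinearMap.mk₂ k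
    (fun x y => (⟨pathMul k x.1 y.1, pathMul_mem k deg h x.2 y.2⟩ : homogeneous k deg l))
    (fun x x' y => Subtype.ext (LinearMap.map_add₂ (pathMul k) x.1 x'.1 y.1))
    (fun c x y => Subtype.ext (LinearMap.map_smul₂ (pathMul k) c x.1 y.1))
    (fun x y y' => Subtype.ext (map_add (pathMul k x.1) y.1 y'.1))
    (fun c x y => Subtype.ext (map_smul (pathMul k x.1) c y.1))
  one := (⟨((1, 1), 0), fun h => absurd rfl h, fun _ _ => rfl⟩ : homogeneous k deg 0)
  one_mul i a := Subtype.ext (by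
    change pathMul k ((1, 1), 0) a.1 = a.1
    ext <;> simp [pathMul])
  mul_one i a := Subtype.ext (by
    change pathMul k a.1 ((1, 1), 0) = a.1
    ext <;> simp [pathMul])
  mul_assoc i j l ij jl m _ _ _ _ a b c := Subtype.ext (by
    change pathMul k (pathMul k a.1 b.1) c.1 = pathMul k a.1 (pathMul k b.1 c.1)
    ext <;> simp [pathMul] <;> ring)
  d_mul i j l i' j' l' _ _ _ h h₁ h₂ a b := by
    refine Eq.symm ?_
    simp only [ModuleCat.hom_zero, LinearMap.zero_apply]
    rw [LinearMap.map_zero₂, map_zero, smul_zero, add_zero]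

end Kronecker

/-! All arrows go from 1 to 2, so e₁Λ = ke₁ and Λe₂ = ke₂. Hence Λe₁ and e₂Λ are two-sided ideals
with sum Λ and intersection V. As bimodules they are Λe₁ ⊗ e₁Λ and Λe₂ ⊗ e₂Λ, while V is Λe₂ ⊗ V ⊗
e₁Λ, so all three are projective. The exact sequence 0 → V → Λe₁ ⊕ e₂Λ → Λ → 0 makes the cone P of
its first map (`resolution`) a homotopically projective resolution of Λ (`quasiIso_augmentation`,
`isHProjective_resolution`).

A morphism P → M amounts to cycles x₁ in e₁M⁰e₁ and x₂ in e₂M⁰e₂ together with a degree 0 linear map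
Y : V[1] → e₂Me₁ such that dY(w) = w x₁ - x₂ w (`homMk`, `hom_ext_resolution`). A null-homotopy
consists of similar data c₁, c₂, Z one degree lower (`mem_nullHomotopic_iff`). Take M = Λ[p], where
d = 0. Then x₁ and x₂ are multiples of e₁ and e₂, zero unless p = 0, and w x₁ = x₂ w forces equal
coefficients because there is an arrow. The map Y is an arbitrary matrix supported on the pairs with
deg α - deg β = p - 1. Homotopies matter only through c₁, c₂ in Λ^(p-1), hence only for p = 1, where
they produce exactly the multiples of the identity of V. So HH^p is this space of matrices, with a
line added for p = 0 and a line divided out for p = 1.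

The passage to the derived category needs no calculus of fractions. If morphisms out of P lift along
quasi-isomorphisms, uniquely up to null-homotopy, then every morphism out of P in the localization
comes from an actual one, by induction on zigzags (`Q_map_surjective`). The functor Hom(P, -) modulo
null-homotopy descends to the localization and detects the kernel (`mem_null_of_Q_map_eq`). -/

namespace LocalizationHom

/-! ### Morphisms in a localization out of an object with the lifting property. -/

variable {C : Type*} [Category* C] (W : MorphismProperty C) (P : C)

/-- If morphisms out of `P` lift along `W` in the localization, then every morphism out of `P` in
the localization comes from a morphism of the original category. -/
theorem Q_map_surjective
    (h : ∀ {N N' : C} (s : N ⟶ N'), W s → ∀ f : P ⟶ N', ∃ g : P ⟶ N,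
      W.Q.map (g ≫ s) = W.Q.map f) (N : C) :
    Function.Surjective (fun f : P ⟶ N => W.Q.map f) := by
  -- Morphisms of the localization are generated by images and formal inverses of `W`, so it
  -- suffices that composing with either kind preserves the set of images of morphisms out of `P`.
  let T : MorphismProperty W.Localization := fun X Y g =>
    ∀ f : P ⟶ (Localization.Construction.objEquiv W).symm X,
      ∃ f' : P ⟶ (Localization.Construction.objEquiv W).symm Y,
        W.Q.map f ≫ g = W.Q.map f'
  have hT : T.IsStableUnderComposition := ⟨fun {X Y Z} g g' hg hg' f => by
    obtain ⟨f₁, h₁⟩ := hg f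
    obtain ⟨f₂, h₂⟩ := hg' f₁
    exact ⟨f₂, by rw [← h₂, ← h₁]; exact (Category.assoc _ _ _).symm⟩⟩
  have top : T = ⊤ := Localization.Construction.morphismProperty_eq_top T
    (fun X Y g f => ⟨f ≫ g, (W.Q.map_comp f g).symm⟩)
    (fun X Y w hw f => by
      -- For the inverse of `w`, a lift `g` of `f` along `w` serves as the new representative.
      obtain ⟨g, hg⟩ := h w hw f
      refine ⟨g, ?_⟩
      have : W.Q.map g ≫ W.Q.map w = W.Q.map f :=
        (W.Q.map_comp g w).symm.trans hg
      have e' : W.Q.map w ≫ Localization.Construction.wInv w hw = 𝟙 _ :=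
        (Localization.Construction.wIso w hw).hom_inv_id
      exact (congrArg (· ≫ Localization.Construction.wInv w hw) this).symm.trans
        ((Category.assoc _ _ _).trans ((congrArg (W.Q.map g ≫ ·) e').trans (Category.comp_id _))))
  intro g
  have hg : T g := by rw [top]; trivial
  obtain ⟨f', hf'⟩ := hg (𝟙 P)
  refine ⟨f', ?_⟩
  have h1 : W.Q.map (𝟙 P) ≫ g = g :=
    (congrArg (· ≫ g) (W.Q.map_id P)).trans (Category.id_comp g)
  exact hf'.symm.trans h1

variable [Preadditive C]

/-- The functor of morphisms out of `P` modulo an ideal of null morphisms. -/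
def homModNull (null : ∀ N : C, AddSubgroup (P ⟶ N))
    (hcomp : ∀ {N N' : C} (f : P ⟶ N) (s : N ⟶ N'), f ∈ null N → f ≫ s ∈ null N') :
    C ⥤ Type _ where
  obj N := (P ⟶ N) ⧸ null N
  map {N N'} s := TypeCat.ofHom (QuotientAddGroup.map (null N) (null N')
    (Preadditive.rightComp P s) (fun f hf => hcomp f s hf))
  map_id N := by
    ext x
    induction x using QuotientAddGroup.induction_on with
    | H f => exact congrArg _ (Category.comp_id f)
  map_comp s t := by
    ext x
    induction x using QuotientAddGroup.induction_on with
    | H f => exact congrArg _ (Category.assoc f s t).symm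

/-- If the morphisms of `W` induce bijections on morphisms out of `P` modulo null morphisms, then
morphisms out of `P` which become equal in the localization are equal modulo null morphisms. -/
theorem mem_null_of_Q_map_eq (null : ∀ N : C, AddSubgroup (P ⟶ N))
    (hcomp : ∀ {N N' : C} (f : P ⟶ N) (s : N ⟶ N'), f ∈ null N → f ≫ s ∈ null N')
    (hsurj : ∀ {N N' : C} (s : N ⟶ N'), W s → ∀ f : P ⟶ N', ∃ g : P ⟶ N, g ≫ s - f ∈ null N')
    (hinj : ∀ {N N' : C} (s : N ⟶ N'), W s → ∀ f : P ⟶ N, f ≫ s ∈ null N' → f ∈ null N)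
    {N : C} {f g : P ⟶ N} (h : W.Q.map f = W.Q.map g) : f - g ∈ null N := by
  -- This functor inverts `W`, so it factors through the localization and cannot separate `f` from
  -- `g`.
  let F := homModNull P null @hcomp
  have hF : W.IsInvertedBy F := by
    intro X Y s hs
    rw [isIso_iff_bijective]
    constructor
    · intro x y hxy
      induction x using QuotientAddGroup.induction_on with | H x =>
      induction y using QuotientAddGroup.induction_on with | H y =>
      have h1 := QuotientAddGroup.eq.1
        (show ((x ≫ s : P ⟶ Y) : (P ⟶ Y) ⧸ null Y) = (y ≫ s : P ⟶ Y) from hxy)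
      refine QuotientAddGroup.eq.2 (hinj s hs _ ?_)
      rwa [Preadditive.add_comp, Preadditive.neg_comp]
    · intro y
      induction y using QuotientAddGroup.induction_on with | H y =>
      obtain ⟨x, hx⟩ := hsurj s hs y
      refine ⟨(x : (P ⟶ X) ⧸ null X), ?_⟩
      have hx' := (null Y).neg_mem hx
      refine QuotientAddGroup.eq.2 ?_
      have : -(x ≫ s) + y = -(x ≫ s - y) := by abel
      change -(x ≫ s) + y ∈ null Y
      rwa [this]
  have e : F.map f = F.map g := by
    have := congrArg (Localization.lift F hF W.Q).map h
    have e1 := NatIso.naturality_1 (Localization.fac F hF W.Q) f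
    have e2 := NatIso.naturality_1 (Localization.fac F hF W.Q) g
    rw [← e1, ← e2]
    simp only [Functor.comp_map, this]
  -- As in the Yoneda lemma, evaluating at the class of the identity recovers the classes of `f` and
  -- `g`.
  have e' := ConcreteCategory.congr_hom e ((𝟙 P : P ⟶ P) : (P ⟶ P) ⧸ null P)
  have e3 : ((𝟙 P ≫ f : P ⟶ N) : (P ⟶ N) ⧸ null N) = (𝟙 P ≫ g : P ⟶ N) := e'
  rw [Category.id_comp, Category.id_comp] at e3
  have := (null N).neg_mem (QuotientAddGroup.eq.1 e3)
  rwa [neg_add, neg_neg, ← sub_eq_add_neg] at this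

end LocalizationHom

/-! ### Quasi-isomorphisms of complexes of vector spaces, in terms of elements. -/

namespace CategoryTheory.ShortComplex

variable {k : Type u} [Field k] {S T : ShortComplex (ModuleCat.{u} k)}

/-- Quasi-isomorphisms of short complexes of vector spaces, in terms of elements. -/
theorem moduleCat_quasiIso_iff (φ : S ⟶ T) :
    QuasiIso φ ↔
      (∀ y : T.X₂, T.g y = 0 → ∃ x : S.X₂, S.g x = 0 ∧ ∃ z : T.X₁, φ.τ₂ x = y + T.f z) ∧
      (∀ x : S.X₂, S.g x = 0 → (∃ z : T.X₁, φ.τ₂ x = T.f z) → ∃ z : S.X₁, x = S.f z) := by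
  -- Homology is modelled as kernel modulo range; the two conditions then express surjectivity and
  -- injectivity of the induced map `b`.
  let γ : LeftHomologyMapData φ S.moduleCatLeftHomologyData T.moduleCatLeftHomologyData := default
  let a : LinearMap.ker S.g.hom →ₗ[k] LinearMap.ker T.g.hom := γ.φK.hom
  let b : (LinearMap.ker S.g.hom ⧸ LinearMap.range S.moduleCatToCycles) →ₗ[k]
    (LinearMap.ker T.g.hom ⧸ LinearMap.range T.moduleCatToCycles) := γ.φH.hom
  have hK (x : LinearMap.ker S.g.hom) : (a x : T.X₂) = φ.τ₂ (x : S.X₂) :=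
    LinearMap.congr_fun (ModuleCat.hom_ext_iff.1 γ.commi) x
  have hH (x : LinearMap.ker S.g.hom) :
      b ((LinearMap.range S.moduleCatToCycles).mkQ x) =
        (LinearMap.range T.moduleCatToCycles).mkQ (a x) :=
    LinearMap.congr_fun (ModuleCat.hom_ext_iff.1 γ.commπ) x
  rw [γ.quasiIso_iff, ConcreteCategory.isIso_iff_bijective, and_comm]
  change Function.Injective b ∧ Function.Surjective b ↔ _
  refine and_congr ⟨fun h x hx hz => ?_, fun h => ?_⟩ ⟨fun h y hy => ?_, fun h y => ?_⟩
  · obtain ⟨z, hz⟩ := hz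
    have h1 : b ((LinearMap.range S.moduleCatToCycles).mkQ ⟨x, hx⟩) = b 0 := by
      rw [hH, map_zero, Submodule.mkQ_apply, Submodule.Quotient.mk_eq_zero]
      exact ⟨z, Subtype.ext (hz.symm.trans (hK ⟨x, hx⟩).symm)⟩
    have h2 := h h1
    rw [Submodule.mkQ_apply, Submodule.Quotient.mk_eq_zero] at h2
    obtain ⟨w, hw⟩ := h2
    exact ⟨w, (congrArg Subtype.val hw).symm⟩
  · rw [injective_iff_map_eq_zero]
    intro x hx
    obtain ⟨x, rfl⟩ := Submodule.mkQ_surjective _ x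
    rw [hH, Submodule.mkQ_apply, Submodule.Quotient.mk_eq_zero] at hx
    obtain ⟨z, hz⟩ := hx
    obtain ⟨w, hw⟩ := h x.1 x.2 ⟨z, (hK x).symm.trans (congrArg Subtype.val hz).symm⟩
    rw [Submodule.mkQ_apply, Submodule.Quotient.mk_eq_zero]
    exact ⟨w, Subtype.ext hw.symm⟩
  · obtain ⟨x, hx⟩ := h ((LinearMap.range T.moduleCatToCycles).mkQ ⟨y, hy⟩)
    obtain ⟨x, rfl⟩ := Submodule.mkQ_surjective _ x
    rw [hH, ← sub_eq_zero, ← map_sub, Submodule.mkQ_apply, Submodule.Quotient.mk_eq_zero] at hx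
    obtain ⟨z, hz⟩ := hx
    refine ⟨x.1, x.2, z, ?_⟩
    rw [← hK x, ← sub_eq_iff_eq_add']
    exact (congrArg Subtype.val hz).symm
  · obtain ⟨y, rfl⟩ := Submodule.mkQ_surjective _ y
    obtain ⟨x, hx, z, hz⟩ := h y.1 y.2
    refine ⟨(LinearMap.range S.moduleCatToCycles).mkQ ⟨x, hx⟩, ?_⟩
    rw [hH, ← sub_eq_zero, ← map_sub, Submodule.mkQ_apply, Submodule.Quotient.mk_eq_zero]
    refine ⟨z, Subtype.ext ?_⟩
    change T.f z = (a ⟨x, hx⟩ : T.X₂) - y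
    rw [hK, hz, add_sub_cancel_left]

end CategoryTheory.ShortComplex

namespace CochainComplex

variable {k : Type u} [Field k] {M N : CochainComplex (ModuleCat.{u} k) ℤ}

/-- Quasi-isomorphisms of complexes of vector spaces, in terms of elements. -/
theorem moduleCat_quasiIso_iff (φ : M ⟶ N) :
    QuasiIso φ ↔ ∀ i j l : ℤ, i + 1 = j → j + 1 = l →
      (∀ y : N.X j, N.d j l y = 0 →
        ∃ x : M.X j, M.d j l x = 0 ∧ ∃ z : N.X i, φ.f j x = y + N.d i j z) ∧
      (∀ x : M.X j, M.d j l x = 0 → (∃ z : N.X i, φ.f j x = N.d i j z) →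
        ∃ z : M.X i, x = M.d i j z) := by
  rw [_root_.quasiIso_iff]
  have key (i j l : ℤ) (hi : i + 1 = j) (hl : j + 1 = l) :=
    (quasiIsoAt_iff' φ i j l ((ComplexShape.up ℤ).prev_eq' hi)
      ((ComplexShape.up ℤ).next_eq' hl)).trans (ShortComplex.moduleCat_quasiIso_iff _)
  exact ⟨fun h i j l hi hl => (key i j l hi hl).1 (h j),
    fun h j => (key (j - 1) j (j + 1) (by lia) rfl).2 (h _ _ _ (by lia) rfl)⟩

end CochainComplex

/-! ### Identifications between components of equal degrees. -/

namespace CochainComplex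

variable {k : Type u} [Field k]

/-- The identification of two components of a complex whose degrees are equal, extended by `0` to
the other pairs of components. -/
noncomputable def castX (M : CochainComplex (ModuleCat.{u} k) ℤ) (i j : ℤ) :
    M.X i →ₗ[k] M.X j :=
  if h : i = j then (M.XIsoOfEq h).hom.hom else 0

variable (M : CochainComplex (ModuleCat.{u} k) ℤ)

@[simp]
theorem castX_self (i : ℤ) (x : M.X i) : castX M i i x = x := by
  simp [castX]

theorem castX_of_ne {i j : ℤ} (h : i ≠ j) (x : M.X i) : castX M i j x = 0 := by
  simp [castX, h]

theorem castX_d {i j i' j' : ℤ} (hi : i = i') (hj : j = j') (x : M.X i) :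
    castX M j j' (M.d i j x) = M.d i' j' (castX M i i' x) := by
  subst hi hj
  simp

theorem castX_map {M N : CochainComplex (ModuleCat.{u} k) ℤ} (φ : M ⟶ N) (i j : ℤ) (x : M.X i) :
    φ.f j (castX M i j x) = castX N i j (φ.f i x) := by
  by_cases h : i = j
  · subst h
    simp
  · simp [castX_of_ne _ h]

theorem d_d_apply (i j l : ℤ) (x : M.X i) : M.d j l (M.d i j x) = 0 :=
  LinearMap.congr_fun (ModuleCat.hom_ext_iff.1 (M.d_comp_d i j l)) x

theorem map_d_apply {M N : CochainComplex (ModuleCat.{u} k) ℤ} (φ : M ⟶ N) (i j : ℤ) (x : M.X i) :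
    φ.f j (M.d i j x) = N.d i j (φ.f i x) :=
  LinearMap.congr_fun (ModuleCat.hom_ext_iff.1 (φ.comm i j)).symm x

end CochainComplex

/-! ### Contractible bimodules, null-homotopy and homotopical projectivity. -/

namespace DGBimodule

open CochainComplex

variable {k : Type u} [Field k] {A : DGAlgebra k}

theorem castX_lact (M : DGBimodule A) {i j n j' n' : ℤ} (h : i + j = n) (h' : i + j' = n')
    (hj : j = j') (a : A.cx.X i) (m : M.cx.X j) :
    castX M.cx n n' (M.lact i j n h a m) = M.lact i j' n' h' a (castX M.cx j j' m) := by
  subst hj h h'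
  simp

theorem castX_ract (M : DGBimodule A) {i j n i' n' : ℤ} (h : i + j = n) (h' : i' + j = n')
    (hi : i = i') (m : M.cx.X i) (a : A.cx.X j) :
    castX M.cx n n' (M.ract i j n h m a) = M.ract i' j n' h' (castX M.cx i i' m) a := by
  subst hi h h'
  simp

/-- The contractible dg bimodule `cone(id)[-1]` over a dg bimodule `M`. -/
noncomputable def pathOver (M : DGBimodule A) : DGBimodule A where
  cx :=
    { X := fun i => ModuleCat.of k (M.cx.X i × M.cx.X (i - 1))
      -- The `castX` entry is the identity of `M`, read between the degrees `i` and `j - 1`; it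
      -- vanishes when these differ, as `shape` demands.
      d := fun i j => ModuleCat.ofHom
        (((M.cx.d i j).hom ∘ₗ LinearMap.fst k _ _).prod
          (castX M.cx i (j - 1) ∘ₗ LinearMap.fst k _ _ -
            (M.cx.d (i - 1) (j - 1)).hom ∘ₗ LinearMap.snd k _ _))
      shape := fun i j h => by
        have h' : ¬ i + 1 = j := h
        refine ModuleCat.hom_ext (LinearMap.ext fun x => Prod.ext ?_ ?_)
        · change M.cx.d i j x.1 = 0
          rw [M.cx.shape i j h]
          rfl
        · change castX M.cx i (j - 1) x.1 - M.cx.d (i - 1) (j - 1) x.2 = 0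
          rw [castX_of_ne _ (by lia), M.cx.shape (i - 1) (j - 1)
            (fun e : i - 1 + 1 = j - 1 => h' (by lia))]
          exact sub_zero _
      d_comp_d' := fun i j l hij hjl => by
        have hij' : i + 1 = j := hij
        have hjl' : j + 1 = l := hjl
        refine ModuleCat.hom_ext (LinearMap.ext fun x => Prod.ext (d_d_apply M.cx i j l x.1) ?_)
        change castX M.cx j (l - 1) (M.cx.d i j x.1) - M.cx.d (j - 1) (l - 1)
          (castX M.cx i (j - 1) x.1 - M.cx.d (i - 1) (j - 1) x.2) = 0
        rw [map_sub, d_d_apply, castX_d M.cx (by lia : i = j - 1) (by lia), sub_zero, sub_self] }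
  -- The second factor is `M[-1]`, hence a sign in the left action and none in the right one.
  lact i j n h := LinearMap.mk₂ k
    (fun a m => ((M.lact i j n h a m.1,
      i.negOnePow • M.lact i (j - 1) (n - 1) (by lia) a m.2) : M.cx.X n × M.cx.X (n - 1)))
    (by intros; ext <;> simp) (by intros; ext <;> simp [smul_comm i.negOnePow])
    (by intros; ext <;> simp) (by intros; ext <;> simp [smul_comm i.negOnePow])
  ract i j n h := LinearMap.mk₂ k
    (fun m a => ((M.ract i j n h m.1 a,
      M.ract (i - 1) j (n - 1) (by lia) m.2 a) : M.cx.X n × M.cx.X (n - 1)))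
    (by intros; ext <;> simp) (by intros; ext <;> simp)
    (by intros; ext <;> simp) (by intros; ext <;> simp)
  one_lact i m := Prod.ext (M.one_lact i m.1) (by
    change (0 : ℤ).negOnePow • M.lact 0 (i - 1) (i - 1) _ A.one m.2 = m.2
    rw [Int.negOnePow_zero, one_smul, M.one_lact])
  ract_one i m := Prod.ext (M.ract_one i m.1) (M.ract_one (i - 1) m.2)
  lact_assoc i j l ij jl n h₁ h₂ h₃ h₄ a b m :=
    Prod.ext (M.lact_assoc i j l ij jl n h₁ h₂ h₃ h₄ a b m.1) (by
      change ij.negOnePow • M.lact ij (l - 1) (n - 1) _ (A.mul i j ij h₁ a b) m.2 =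
        i.negOnePow • M.lact i (jl - 1) (n - 1) _ a
          (j.negOnePow • M.lact j (l - 1) (jl - 1) _ b m.2)
      rw [M.lact_assoc i j (l - 1) ij (jl - 1) (n - 1) h₁ (by lia) (by lia) (by lia),
        map_units_smul, smul_smul, ← Int.negOnePow_add, h₁])
  ract_assoc i j l ij jl n h₁ h₂ h₃ h₄ m a b :=
    Prod.ext (M.ract_assoc i j l ij jl n h₁ h₂ h₃ h₄ m.1 a b)
      (M.ract_assoc (i - 1) j l (ij - 1) jl (n - 1) (by lia) h₂ (by lia) (by lia) m.2 a b)
  lact_ract i j l ij jl n h₁ h₂ h₃ h₄ a m b :=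
    Prod.ext (M.lact_ract i j l ij jl n h₁ h₂ h₃ h₄ a m.1 b) (by
      change M.ract (ij - 1) l (n - 1) _ (i.negOnePow • M.lact i (j - 1) (ij - 1) _ a m.2) b =
        i.negOnePow • M.lact i (jl - 1) (n - 1) _ a (M.ract (j - 1) l (jl - 1) _ m.2 b)
      rw [← M.lact_ract i (j - 1) l (ij - 1) (jl - 1) (n - 1) (by lia) (by lia) (by lia) (by lia),
        ← LinearMap.flip_apply, map_units_smul, LinearMap.flip_apply])
  d_lact i j n i' j' n' hi hj hn h h₁ h₂ a m :=
    Prod.ext (M.d_lact i j n i' j' n' hi hj hn h h₁ h₂ a m.1) (by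
      have hd := M.d_lact i (j - 1) (n - 1) i' (j' - 1) (n' - 1) hi (by lia) (by lia) (by lia)
        (by lia) (by lia) a m.2
      have e : i'.negOnePow = - i.negOnePow := by rw [← hi, Int.negOnePow_succ]
      change castX M.cx n (n' - 1) (M.lact i j n h a m.1) - M.cx.d (n - 1) (n' - 1)
          (i.negOnePow • M.lact i (j - 1) (n - 1) _ a m.2) =
        i'.negOnePow • M.lact i' (j - 1) (n' - 1) _ (A.cx.d i i' a) m.2 +
          i.negOnePow • i.negOnePow • M.lact i (j' - 1) (n' - 1) _ a
            (castX M.cx j (j' - 1) m.1 - M.cx.d (j - 1) (j' - 1) m.2)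
      rw [map_units_smul (M.cx.d (n - 1) (n' - 1)).hom, hd,
        castX_lact M h (by lia : i + (j' - 1) = n' - 1) (by lia), e, smul_smul,
        Int.units_mul_self, one_smul, map_sub, smul_add, smul_smul, Int.units_mul_self, one_smul,
        Units.neg_smul]
      abel)
  d_ract i j n i' j' n' hi hj hn h h₁ h₂ m a :=
    Prod.ext (M.d_ract i j n i' j' n' hi hj hn h h₁ h₂ m.1 a) (by
      have hd := M.d_ract (i - 1) j (n - 1) (i' - 1) j' (n' - 1) (by lia) hj (by lia) (by lia)
        (by lia) (by lia) m.2 a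
      have e : (i - 1).negOnePow = - i.negOnePow := by rw [Int.negOnePow_sub]; simp
      change castX M.cx n (n' - 1) (M.ract i j n h m.1 a) - M.cx.d (n - 1) (n' - 1)
          (M.ract (i - 1) j (n - 1) _ m.2 a) =
        M.ract (i' - 1) j (n' - 1) _
          (castX M.cx i (i' - 1) m.1 - M.cx.d (i - 1) (i' - 1) m.2) a +
          i.negOnePow • M.ract (i - 1) j' (n' - 1) _ m.2 (A.cx.d j j' a)
      rw [hd, castX_ract M h (by lia : i' - 1 + j = n' - 1) (by lia), e, map_sub,
        LinearMap.sub_apply, Units.neg_smul]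
      abel)

/-- The projection from the contractible dg bimodule over `M` to `M`. -/
noncomputable def pathOverFst (M : DGBimodule A) : pathOver M ⟶ M :=
  ⟨{ f := fun i => ModuleCat.ofHom (LinearMap.fst k (M.cx.X i) (M.cx.X (i - 1))) },
    fun _ _ _ _ _ _ => rfl, fun _ _ _ _ _ _ => rfl⟩

/-- The functoriality of the contractible dg bimodule over `M`. -/
noncomputable def pathOverMap {M N : DGBimodule A} (φ : M ⟶ N) : pathOver M ⟶ pathOver N :=
  ⟨{ f := fun i => ModuleCat.ofHom ((φ.1.f i).hom.prodMap (φ.1.f (i - 1)).hom)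
     comm' := fun i j _ => by
      refine ModuleCat.hom_ext (LinearMap.ext fun x => Prod.ext ?_ ?_)
      · exact (map_d_apply φ.1 i j x.1).symm
      · change castX N.cx i (j - 1) (φ.1.f i x.1) - N.cx.d (i - 1) (j - 1) (φ.1.f (i - 1) x.2) =
          φ.1.f (j - 1) (castX M.cx i (j - 1) x.1 - M.cx.d (i - 1) (j - 1) x.2)
        rw [map_sub, castX_map, map_d_apply] },
    fun i j n h a m => Prod.ext (φ.2.1 i j n h a m.1) (by
      change φ.1.f (n - 1) (i.negOnePow • M.lact i (j - 1) (n - 1) _ a m.2) =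
        i.negOnePow • N.lact i (j - 1) (n - 1) _ a (φ.1.f (j - 1) m.2)
      rw [map_units_smul, φ.2.1]),
    fun i j n h m a => Prod.ext (φ.2.2 i j n h m.1 a) (φ.2.2 _ _ _ _ m.2 a)⟩

theorem pathOverMap_fst {M N : DGBimodule A} (φ : M ⟶ N) :
    pathOverMap φ ≫ pathOverFst N = pathOverFst M ≫ φ := rfl

theorem quasiIso_iff_elements {M N : DGBimodule A} (φ : M ⟶ N) :
    quasiIso A φ ↔ ∀ i j l : ℤ, i + 1 = j → j + 1 = l →
      (∀ y : N.cx.X j, N.cx.d j l y = 0 →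
        ∃ x : M.cx.X j, M.cx.d j l x = 0 ∧ ∃ z : N.cx.X i, φ.1.f j x = y + N.cx.d i j z) ∧
      (∀ x : M.cx.X j, M.cx.d j l x = 0 → (∃ z : N.cx.X i, φ.1.f j x = N.cx.d i j z) →
        ∃ z : M.cx.X i, x = M.cx.d i j z) :=
  CochainComplex.moduleCat_quasiIso_iff φ.1

/-- A cycle (a, c) satisfies a = dc, so it is the boundary of (c, 0). The bimodule is thus acyclic,
and every endomorphism of it is a quasi-isomorphism. -/
theorem quasiIso_zero_pathOver (M : DGBimodule A) :
    quasiIso A (0 : pathOver M ⟶ pathOver M) := by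
  rw [quasiIso_iff_elements]
  intro i j l hij hjl
  have key (y : (pathOver M).cx.X j) (hy : (pathOver M).cx.d j l y = 0) :
      ∃ z : (pathOver M).cx.X i, y = (pathOver M).cx.d i j z := by
    obtain ⟨a, c⟩ := y
    have h1 : M.cx.d j l a = 0 := congrArg Prod.fst hy
    have h2 : castX M.cx j (l - 1) a - M.cx.d (j - 1) (l - 1) c = 0 := congrArg Prod.snd hy
    obtain rfl : l - 1 = j := by lia
    obtain rfl : l - 1 - 1 = i := by lia
    rw [castX_self] at h2
    refine ⟨(c, 0), Prod.ext (sub_eq_zero.1 h2) ?_⟩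
    change c = castX M.cx (l - 1 - 1) (l - 1 - 1) c - M.cx.d _ _ 0
    rw [castX_self, map_zero, sub_zero]
  refine ⟨fun y hy => ⟨0, map_zero _, ?_⟩, fun x hx _ => key x hx⟩
  obtain ⟨z, rfl⟩ := key y hy
  refine ⟨-z, ?_⟩
  rw [map_zero, map_neg, add_neg_cancel]

/-- Once the zero endomorphism becomes invertible, the identity of `pathOver M` is zero in the
derived category. -/
theorem Q_map_pathOverFst (M : DGBimodule A) : (quasiIso A).Q.map (pathOverFst M) = 0 := by
  have := Localization.inverts (quasiIso A).Q (quasiIso A) _ (quasiIso_zero_pathOver M)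
  rw [Functor.map_zero] at this
  have h0 : (𝟙 ((quasiIso A).Q.obj (pathOver M))) = 0 := by
    rw [← IsIso.hom_inv_id (0 : (quasiIso A).Q.obj (pathOver M) ⟶ (quasiIso A).Q.obj (pathOver M)),
      zero_comp]
  rw [← Category.id_comp ((quasiIso A).Q.map (pathOverFst M)), h0, zero_comp]

/-- The null-homotopic morphisms: those which factor through the contractible dg bimodule over the
target. -/
noncomputable def nullHomotopic (P M : DGBimodule A) : Submodule k (P ⟶ M) :=
  LinearMap.range (Linear.rightComp k P (pathOverFst M))

/-- Functoriality of `pathOver` gives stability under postcomposition, which `homModNull` requires.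
-/
theorem comp_mem_nullHomotopic {P M N : DGBimodule A} (f : P ⟶ M) (s : M ⟶ N)
    (hf : f ∈ nullHomotopic P M) : f ≫ s ∈ nullHomotopic P N := by
  obtain ⟨g, rfl⟩ := hf
  refine ⟨g ≫ pathOverMap s, ?_⟩
  change (g ≫ pathOverMap s) ≫ pathOverFst N = (g ≫ pathOverFst M) ≫ s
  rw [Category.assoc, pathOverMap_fst, Category.assoc]

theorem Q_map_eq_zero {P M : DGBimodule A} (f : P ⟶ M) (hf : f ∈ nullHomotopic P M) :
    (quasiIso A).Q.map f = 0 := by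
  obtain ⟨g, rfl⟩ := hf
  change (quasiIso A).Q.map (g ≫ pathOverFst M) = 0
  rw [Functor.map_comp, Q_map_pathOverFst, comp_zero]

/-- A dg bimodule `P` is homotopically projective if, up to homotopy, morphisms out of `P` lift
uniquely along quasi-isomorphisms. -/
structure IsHProjective (P : DGBimodule A) : Prop where
  exists_lift : ∀ {M N : DGBimodule A} (s : M ⟶ N), quasiIso A s → ∀ f : P ⟶ N,
    ∃ g : P ⟶ M, g ≫ s - f ∈ nullHomotopic P N
  mem_nullHomotopic : ∀ {M N : DGBimodule A} (s : M ⟶ N), quasiIso A s → ∀ f : P ⟶ M,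
    f ≫ s ∈ nullHomotopic P N → f ∈ nullHomotopic P M

/-- Morphisms in the derived category out of a homotopically projective dg bimodule are homotopy
classes of morphisms. -/
noncomputable def IsHProjective.homEquiv {P : DGBimodule A} (hP : IsHProjective P)
    (M : DGBimodule A) :
    ((P ⟶ M) ⧸ nullHomotopic P M) ≃ₗ[k] ((quasiIso A).Q.obj P ⟶ (quasiIso A).Q.obj M) := by
  let φ : (P ⟶ M) →ₗ[k] ((quasiIso A).Q.obj P ⟶ (quasiIso A).Q.obj M) :=
    (quasiIso A).Q.mapLinearMap k
  have hker : nullHomotopic P M = LinearMap.ker φ := by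
    ext f
    refine ⟨Q_map_eq_zero f, fun hf => ?_⟩
    have := LocalizationHom.mem_null_of_Q_map_eq (quasiIso A) P
      (fun N => (nullHomotopic P N).toAddSubgroup)
      (fun f s hf => comp_mem_nullHomotopic f s hf) hP.exists_lift hP.mem_nullHomotopic
      (f := f) (g := 0) (by rw [Functor.map_zero]; exact hf)
    rwa [sub_zero] at this
  have hsurj : Function.Surjective φ := by
    refine LocalizationHom.Q_map_surjective (quasiIso A) P (fun s hs f => ?_) M
    obtain ⟨g, hg⟩ := hP.exists_lift s hs f
    refine ⟨g, ?_⟩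
    have := Q_map_eq_zero _ hg
    rwa [Functor.map_sub, sub_eq_zero] at this
  exact (Submodule.quotEquivOfEq _ _ hker).trans (φ.quotKerEquivOfSurjective hsurj)

end DGBimodule

/-! ### The ideals Λe₁, e₂Λ and V of the Kronecker algebra. -/

namespace Kronecker

open CochainComplex

section

variable (k : Type u) [Field k] {n : ℕ} (deg : Fin n → ℤ)

/-- The inclusion of the homogeneous part of degree `i` into the path algebra. -/
def toPath (i : ℤ) : (dgAlgebra k deg).cx.X i →ₗ[k] PathAlgebra k n :=
  (homogeneous k deg i).subtype

/-- The idempotent `e₁`. -/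
def e₁ : (dgAlgebra k deg).cx.X 0 :=
  (⟨((1, 0), 0), fun h => absurd rfl h, fun _ _ => rfl⟩ : homogeneous k deg 0)

/-- The idempotent `e₂`. -/
def e₂ : (dgAlgebra k deg).cx.X 0 :=
  (⟨((0, 1), 0), fun h => absurd rfl h, fun _ _ => rfl⟩ : homogeneous k deg 0)

/-- The homogeneous parts of the ideal `Λ e₁`. -/
def idealL (i : ℤ) : Submodule k ((dgAlgebra k deg).cx.X i) where
  carrier := { x | (toPath k deg i x).1.2 = 0 }
  add_mem' hx hy := by simp_all
  zero_mem' := by simp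
  smul_mem' c x hx := by simp_all

/-- The homogeneous parts of the ideal `e₂ Λ`. -/
def idealR (i : ℤ) : Submodule k ((dgAlgebra k deg).cx.X i) where
  carrier := { x | (toPath k deg i x).1.1 = 0 }
  add_mem' hx hy := by simp_all
  zero_mem' := by simp
  smul_mem' c x hx := by simp_all

/-- The homogeneous parts of the ideal `V` spanned by the arrows. -/
def idealV (i : ℤ) : Submodule k ((dgAlgebra k deg).cx.X i) := idealL k deg i ⊓ idealR k deg i

end

variable {k : Type u} [Field k] {n : ℕ} {deg : Fin n → ℤ}

theorem toPath_injective (i : ℤ) : Function.Injective (toPath k deg i) := Subtype.val_injective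

theorem toPath_mul (i j l : ℤ) (h : i + j = l) (x : (dgAlgebra k deg).cx.X i)
    (y : (dgAlgebra k deg).cx.X j) :
    toPath k deg l ((dgAlgebra k deg).mul i j l h x y) =
      pathMul k (toPath k deg i x) (toPath k deg j y) := rfl

theorem toPath_fst_eq_zero {i : ℤ} (hi : i ≠ 0) (x : (dgAlgebra k deg).cx.X i) :
    (toPath k deg i x).1 = 0 := Subtype.prop (p := (· ∈ homogeneous k deg i)) x |>.1 hi

theorem pathMul_apply (x y : PathAlgebra k n) : pathMul k x y =
    ((x.1.1 * y.1.1, x.1.2 * y.1.2), fun α => x.2 α * y.1.1 + x.1.2 * y.2 α) := rfl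

theorem toPath_e₁ : toPath k deg 0 (e₁ k deg) = ((1, 0), 0) := rfl

theorem toPath_e₂ : toPath k deg 0 (e₂ k deg) = ((0, 1), 0) := rfl

theorem mem_idealL {i : ℤ} {x : (dgAlgebra k deg).cx.X i} :
    x ∈ idealL k deg i ↔ (toPath k deg i x).1.2 = 0 := Iff.rfl

theorem mem_idealR {i : ℤ} {x : (dgAlgebra k deg).cx.X i} :
    x ∈ idealR k deg i ↔ (toPath k deg i x).1.1 = 0 := Iff.rfl

theorem e₁_mem_idealL : e₁ k deg ∈ idealL k deg 0 := rfl

theorem e₂_mem_idealR : e₂ k deg ∈ idealR k deg 0 := rfl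

/-- The coefficients of e₁ and of e₂ are multiplicative, so their kernels e₂Λ and Λe₁ are two-sided
ideals. -/
theorem mul_mem_idealL {i j l : ℤ} (h : i + j = l) (a : (dgAlgebra k deg).cx.X i)
    {x : (dgAlgebra k deg).cx.X j} (hx : x ∈ idealL k deg j) :
    (dgAlgebra k deg).mul i j l h a x ∈ idealL k deg l := by
  rw [mem_idealL] at hx ⊢
  rw [toPath_mul, pathMul_apply]
  simp [hx]

theorem mul_mem_idealL' {i j l : ℤ} (h : i + j = l) {x : (dgAlgebra k deg).cx.X i}
    (hx : x ∈ idealL k deg i) (a : (dgAlgebra k deg).cx.X j) :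
    (dgAlgebra k deg).mul i j l h x a ∈ idealL k deg l := by
  rw [mem_idealL] at hx ⊢
  rw [toPath_mul, pathMul_apply]
  simp [hx]

theorem mul_mem_idealR {i j l : ℤ} (h : i + j = l) (a : (dgAlgebra k deg).cx.X i)
    {x : (dgAlgebra k deg).cx.X j} (hx : x ∈ idealR k deg j) :
    (dgAlgebra k deg).mul i j l h a x ∈ idealR k deg l := by
  rw [mem_idealR] at hx ⊢
  rw [toPath_mul, pathMul_apply]
  simp [hx]

theorem mul_mem_idealR' {i j l : ℤ} (h : i + j = l) {x : (dgAlgebra k deg).cx.X i}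
    (hx : x ∈ idealR k deg i) (a : (dgAlgebra k deg).cx.X j) :
    (dgAlgebra k deg).mul i j l h x a ∈ idealR k deg l := by
  rw [mem_idealR] at hx ⊢
  rw [toPath_mul, pathMul_apply]
  simp [hx]

theorem mul_mem_idealV {i j l : ℤ} (h : i + j = l) (a : (dgAlgebra k deg).cx.X i)
    {x : (dgAlgebra k deg).cx.X j} (hx : x ∈ idealV k deg j) :
    (dgAlgebra k deg).mul i j l h a x ∈ idealV k deg l :=
  ⟨mul_mem_idealL h a hx.1, mul_mem_idealR h a hx.2⟩

theorem mul_mem_idealV' {i j l : ℤ} (h : i + j = l) {x : (dgAlgebra k deg).cx.X i}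
    (hx : x ∈ idealV k deg i) (a : (dgAlgebra k deg).cx.X j) :
    (dgAlgebra k deg).mul i j l h x a ∈ idealV k deg l :=
  ⟨mul_mem_idealL' h hx.1 a, mul_mem_idealR' h hx.2 a⟩

theorem castX_mem_idealL (i j : ℤ) {x : (dgAlgebra k deg).cx.X i} (hx : x ∈ idealL k deg i) :
    castX (dgAlgebra k deg).cx i j x ∈ idealL k deg j := by
  by_cases h : i = j
  · subst h
    simpa using hx
  · rw [castX_of_ne _ h]
    exact zero_mem _

theorem castX_mem_idealR (i j : ℤ) {x : (dgAlgebra k deg).cx.X i} (hx : x ∈ idealR k deg i) :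
    castX (dgAlgebra k deg).cx i j x ∈ idealR k deg j := by
  by_cases h : i = j
  · subst h
    simpa using hx
  · rw [castX_of_ne _ h]
    exact zero_mem _

theorem mul_e₁ {i : ℤ} {x : (dgAlgebra k deg).cx.X i} (hx : x ∈ idealL k deg i) :
    (dgAlgebra k deg).mul i 0 i (add_zero i) x (e₁ k deg) = x := by
  refine toPath_injective i ?_
  rw [mem_idealL] at hx
  rw [toPath_mul, pathMul_apply, toPath_e₁]
  ext <;> simp [hx]

theorem e₂_mul {i : ℤ} {x : (dgAlgebra k deg).cx.X i} (hx : x ∈ idealR k deg i) :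
    (dgAlgebra k deg).mul 0 i i (zero_add i) (e₂ k deg) x = x := by
  refine toPath_injective i ?_
  rw [mem_idealR] at hx
  rw [toPath_mul, pathMul_apply, toPath_e₂]
  ext <;> simp [hx]

/-- No arrow ends at the vertex 1, so e₁Λ = ke₁. In degrees other than 0 both sides vanish, and
`castX` allows a uniform statement. -/
theorem e₁_mul (i : ℤ) (x : (dgAlgebra k deg).cx.X i) :
    (dgAlgebra k deg).mul 0 i i (zero_add i) (e₁ k deg) x =
      (toPath k deg i x).1.1 • castX (dgAlgebra k deg).cx 0 i (e₁ k deg) := by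
  refine toPath_injective i ?_
  rw [toPath_mul, pathMul_apply, toPath_e₁]
  by_cases hi : i = 0
  · subst hi
    rw [castX_self, map_smul, toPath_e₁]
    ext <;> simp
  · rw [toPath_fst_eq_zero hi]
    ext <;> simp

/-- Dually, no arrow starts at the vertex 2, so Λe₂ = ke₂. -/
theorem mul_e₂ (i : ℤ) (x : (dgAlgebra k deg).cx.X i) :
    (dgAlgebra k deg).mul i 0 i (add_zero i) x (e₂ k deg) =
      (toPath k deg i x).1.2 • castX (dgAlgebra k deg).cx 0 i (e₂ k deg) := by
  refine toPath_injective i ?_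
  rw [toPath_mul, pathMul_apply, toPath_e₂]
  by_cases hi : i = 0
  · subst hi
    rw [castX_self, map_smul, toPath_e₂]
    ext <;> simp
  · rw [toPath_fst_eq_zero hi]
    ext <;> simp

section

variable {M : DGBimodule (dgAlgebra k deg)}

/-- Write m a = m (e₁ a) and use e₁Λ = ke₁: on Me₁ the algebra acts from the right through a
character. This and its left analogue on e₂M are what make Λe₁, e₂Λ and V projective bimodules. -/
theorem ract_eq_smul {i : ℤ} {m : M.cx.X i} (hm : M.ract i 0 i (add_zero i) m (e₁ k deg) = m)
    (j l : ℤ) (h : i + j = l) (a : (dgAlgebra k deg).cx.X j) :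
    M.ract i j l h m a = (toPath k deg j a).1.1 • castX M.cx i l m := by
  have h1 := M.ract_assoc i 0 j i j l (add_zero i) (zero_add j) h h m (e₁ k deg) a
  rw [hm, e₁_mul, map_smul] at h1
  rw [h1]
  by_cases hj : j = 0
  · subst hj
    obtain rfl : i = l := by lia
    rw [castX_self, castX_self, hm]
  · rw [castX_of_ne _ (Ne.symm hj), castX_of_ne _ (by lia), map_zero]

theorem lact_eq_smul {i : ℤ} {m : M.cx.X i} (hm : M.lact 0 i i (zero_add i) (e₂ k deg) m = m)
    (j l : ℤ) (h : j + i = l) (a : (dgAlgebra k deg).cx.X j) :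
    M.lact j i l h a m = (toPath k deg j a).1.2 • castX M.cx i l m := by
  have h1 := M.lact_assoc j 0 i j i l (add_zero j) (zero_add i) h h a (e₂ k deg) m
  rw [hm, mul_e₂, map_smul] at h1
  rw [← h1]
  by_cases hj : j = 0
  · subst hj
    obtain rfl : i = l := by lia
    rw [castX_self, castX_self, LinearMap.smul_apply, hm]
  · rw [castX_of_ne _ (Ne.symm hj), castX_of_ne _ (by lia), map_zero, smul_zero,
      LinearMap.zero_apply, smul_zero]

theorem d_lact_of_zero (i j l j' l' : ℤ) (hj : j + 1 = j') (h : i + j = l) (h' : i + j' = l')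
    (a : (dgAlgebra k deg).cx.X i) (m : M.cx.X j) :
    M.cx.d l l' (M.lact i j l h a m) = i.negOnePow • M.lact i j' l' h' a (M.cx.d j j' m) := by
  have := M.d_lact i j l (i + 1) j' l' rfl hj (by lia) h (by lia) h' a m
  rw [this]
  have h0 : (dgAlgebra k deg).cx.d i (i + 1) a = 0 := rfl
  rw [h0, LinearMap.map_zero₂, zero_add]

theorem d_ract_of_zero (i j l i' l' : ℤ) (hi : i + 1 = i') (h : i + j = l) (h' : i' + j = l')
    (m : M.cx.X i) (a : (dgAlgebra k deg).cx.X j) :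
    M.cx.d l l' (M.ract i j l h m a) = M.ract i' j l' h' (M.cx.d i i' m) a := by
  have := M.d_ract i j l i' (j + 1) l' hi rfl (by lia) h h' (by lia) m a
  rw [this]
  have h0 : (dgAlgebra k deg).cx.d j (j + 1) a = 0 := rfl
  rw [h0, map_zero, smul_zero, add_zero]

end

theorem mul_eq_smul {i : ℤ} {x : (dgAlgebra k deg).cx.X i} (hx : x ∈ idealL k deg i)
    (j l : ℤ) (h : i + j = l) (a : (dgAlgebra k deg).cx.X j) :
    (dgAlgebra k deg).mul i j l h x a =
      (toPath k deg j a).1.1 • castX (dgAlgebra k deg).cx i l x :=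
  ract_eq_smul (M := DGBimodule.regular (dgAlgebra k deg)) (mul_e₁ hx) j l h a

theorem mul_eq_smul' {i : ℤ} {x : (dgAlgebra k deg).cx.X i} (hx : x ∈ idealR k deg i)
    (j l : ℤ) (h : j + i = l) (a : (dgAlgebra k deg).cx.X j) :
    (dgAlgebra k deg).mul j i l h a x =
      (toPath k deg j a).1.2 • castX (dgAlgebra k deg).cx i l x :=
  lact_eq_smul (M := DGBimodule.regular (dgAlgebra k deg)) (e₂_mul hx) j l h a

/-! ### The resolution of the diagonal bimodule. -/

variable (k deg)

/-- The inclusion of `V` into `Λ e₁`, between components of arbitrary degrees. -/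
noncomputable def inclL (i j : ℤ) : idealV k deg i →ₗ[k] idealL k deg j :=
  (castX (dgAlgebra k deg).cx i j).restrict fun _ hx => castX_mem_idealL i j hx.1

/-- The inclusion of `V` into `e₂ Λ`, between components of arbitrary degrees. -/
noncomputable def inclR (i j : ℤ) : idealV k deg i →ₗ[k] idealR k deg j :=
  (castX (dgAlgebra k deg).cx i j).restrict fun _ hx => castX_mem_idealR i j hx.2

theorem castX_mul_left {i j l j' l' : ℤ} (h : i + j = l) (h' : i + j' = l') (hj : j = j')
    (a : (dgAlgebra k deg).cx.X i) (m : (dgAlgebra k deg).cx.X j) :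
    castX (dgAlgebra k deg).cx l l' ((dgAlgebra k deg).mul i j l h a m) =
      (dgAlgebra k deg).mul i j' l' h' a (castX (dgAlgebra k deg).cx j j' m) :=
  DGBimodule.castX_lact (DGBimodule.regular (dgAlgebra k deg)) h h' hj a m

theorem castX_mul_right {i j l i' l' : ℤ} (h : i + j = l) (h' : i' + j = l') (hi : i = i')
    (m : (dgAlgebra k deg).cx.X i) (a : (dgAlgebra k deg).cx.X j) :
    castX (dgAlgebra k deg).cx l l' ((dgAlgebra k deg).mul i j l h m a) =
      (dgAlgebra k deg).mul i' j l' h' (castX (dgAlgebra k deg).cx i i' m) a :=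
  DGBimodule.castX_ract (DGBimodule.regular (dgAlgebra k deg)) h h' hi m a

theorem coe_units_smul {M : Type*} [AddCommGroup M] [Module k M] (S : Submodule k M) (u : ℤˣ)
    (x : S) : ((u • x : S) : M) = u • (x : M) :=
  map_units_smul S.subtype u x

/-- The restriction of a bilinear map to submodules. -/
def restrictSnd {U V W : Type*} [AddCommGroup U] [Module k U] [AddCommGroup V] [Module k V]
    [AddCommGroup W] [Module k W] (f : U →ₗ[k] V →ₗ[k] W) (p : Submodule k V) (q : Submodule k W)
    (h : ∀ u, ∀ v ∈ p, f u v ∈ q) : U →ₗ[k] p →ₗ[k] q :=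
  LinearMap.mk₂ k (fun u v => ⟨f u v, h u v v.2⟩)
    (fun u u' v => Subtype.ext (LinearMap.map_add₂ f u u' v.1))
    (fun c u v => Subtype.ext (LinearMap.map_smul₂ f c u v.1))
    (fun u v v' => Subtype.ext (map_add (f u) v.1 v'.1))
    (fun c u v => Subtype.ext (map_smul (f u) c v.1))

/-- The left multiplication of the algebra on an ideal. -/
def lmulOn (i j l : ℤ) (h : i + j = l) (p : Submodule k ((dgAlgebra k deg).cx.X j))
    (q : Submodule k ((dgAlgebra k deg).cx.X l))
    (hp : ∀ a, ∀ x ∈ p, (dgAlgebra k deg).mul i j l h a x ∈ q) :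
    (dgAlgebra k deg).cx.X i →ₗ[k] p →ₗ[k] q :=
  restrictSnd k ((dgAlgebra k deg).mul i j l h) p q hp

/-- The right multiplication of the algebra on an ideal. -/
def rmulOn (i j l : ℤ) (h : i + j = l) (p : Submodule k ((dgAlgebra k deg).cx.X i))
    (q : Submodule k ((dgAlgebra k deg).cx.X l))
    (hp : ∀ a, ∀ x ∈ p, (dgAlgebra k deg).mul i j l h x a ∈ q) :
    p →ₗ[k] (dgAlgebra k deg).cx.X j →ₗ[k] q :=
  (restrictSnd k ((dgAlgebra k deg).mul i j l h).flip p q hp).flip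

/-- The left multiplication of the algebra on `V[1]`. -/
def lmulShift (i j l : ℤ) (h : i + j = l) :
    (dgAlgebra k deg).cx.X i →ₗ[k] idealV k deg (j + 1) →ₗ[k] idealV k deg (l + 1) :=
  i.negOnePow • lmulOn k deg i (j + 1) (l + 1) (by lia) _ _ (fun a _ => mul_mem_idealV _ a)

theorem coe_lmulShift (i j l : ℤ) (h : i + j = l) (a : (dgAlgebra k deg).cx.X i)
    (w : idealV k deg (j + 1)) : (lmulShift k deg i j l h a w : (dgAlgebra k deg).cx.X (l + 1)) =
      i.negOnePow • (dgAlgebra k deg).mul i (j + 1) (l + 1) (by lia) a w :=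
  coe_units_smul k _ _ _

/-- The complex underlying the resolution of the diagonal bimodule. -/
noncomputable def resolutionCx : CochainComplex (ModuleCat.{u} k) ℤ where
  X i := ModuleCat.of k (idealL k deg i × idealR k deg i × idealV k deg (i + 1))
  -- The opposite signs of the two inclusions make the sum of the components vanish on boundaries,
  -- so that addition is an augmentation.
  d i j := ModuleCat.ofHom
    ((inclL k deg (i + 1) j ∘ₗ LinearMap.snd k _ _ ∘ₗ LinearMap.snd k _ _).prod
      ((-(inclR k deg (i + 1) j ∘ₗ LinearMap.snd k _ _ ∘ₗ LinearMap.snd k _ _)).prod 0))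
  shape i j h := by
    have h' : ¬ i + 1 = j := h
    refine ModuleCat.hom_ext (LinearMap.ext fun x => Prod.ext (Subtype.ext ?_)
      (Prod.ext (Subtype.ext ?_) rfl))
    · exact castX_of_ne _ h' _
    · exact neg_eq_zero.2 (castX_of_ne _ h' _)
  d_comp_d' i j l _ _ := by
    refine ModuleCat.hom_ext (LinearMap.ext fun x => Prod.ext (Subtype.ext ?_)
      (Prod.ext (Subtype.ext ?_) rfl))
    · exact map_zero (castX _ _ _)
    · exact neg_eq_zero.2 (map_zero (castX _ _ _))

/-- The elements of the resolution. -/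
def resMk {i : ℤ} (l : idealL k deg i) (r : idealR k deg i) (w : idealV k deg (i + 1)) :
    (resolutionCx k deg).X i :=
  ((l, r, w) : idealL k deg i × idealR k deg i × idealV k deg (i + 1))

variable {k deg} in
@[elab_as_elim]
theorem res_induction {i : ℤ} {motive : (resolutionCx k deg).X i → Prop}
    (x : (resolutionCx k deg).X i) (mk : ∀ l r w, motive (resMk k deg l r w)) : motive x :=
  mk x.1 x.2.1 x.2.2

variable {k deg} in
theorem resMk_ext {i : ℤ} {l l' : idealL k deg i} {r r' : idealR k deg i}
    {w w' : idealV k deg (i + 1)} (hl : (l : (dgAlgebra k deg).cx.X i) = l')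
    (hr : (r : (dgAlgebra k deg).cx.X i) = r') (hw : (w : (dgAlgebra k deg).cx.X (i + 1)) = w') :
    resMk k deg l r w = resMk k deg l' r' w' := by
  rw [Subtype.ext hl, Subtype.ext hr, Subtype.ext hw]

theorem resolutionCx_d (i j : ℤ) (l : idealL k deg i) (r : idealR k deg i)
    (w : idealV k deg (i + 1)) :
    (resolutionCx k deg).d i j (resMk k deg l r w) =
      resMk k deg (inclL k deg (i + 1) j w) (-inclR k deg (i + 1) j w) 0 := rfl

/-- The left action on the components of the resolution. -/
def resLactAux (i j l : ℤ) (h : i + j = l) : (dgAlgebra k deg).cx.X i →ₗ[k]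
    (idealL k deg j × idealR k deg j × idealV k deg (j + 1)) →ₗ[k]
      (idealL k deg l × idealR k deg l × idealV k deg (l + 1)) :=
  LinearMap.mk₂ k
    (fun a m => (lmulOn k deg i j l h _ _ (fun a _ => mul_mem_idealL h a) a m.1,
      lmulOn k deg i j l h _ _ (fun a _ => mul_mem_idealR h a) a m.2.1,
      lmulShift k deg i j l h a m.2.2))
    (by intros; simp) (by intros; simp) (by intros; simp) (by intros; simp)

/-- The right action on the components of the resolution. -/
def resRactAux (i j l : ℤ) (h : i + j = l) :
    (idealL k deg i × idealR k deg i × idealV k deg (i + 1)) →ₗ[k] (dgAlgebra k deg).cx.X j →ₗ[k]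
      (idealL k deg l × idealR k deg l × idealV k deg (l + 1)) :=
  LinearMap.mk₂ k
    (fun m a => (rmulOn k deg i j l h _ _ (fun a _ hx => mul_mem_idealL' h hx a) m.1 a,
      rmulOn k deg i j l h _ _ (fun a _ hx => mul_mem_idealR' h hx a) m.2.1 a,
      rmulOn k deg (i + 1) j (l + 1) (by lia) _ _
        (fun a _ hx => mul_mem_idealV' _ hx a) m.2.2 a))
    (by intros; simp) (by intros; simp) (by intros; simp) (by intros; simp)

/-- The left action on the resolution. -/
def resLact (i j l : ℤ) (h : i + j = l) :
    (dgAlgebra k deg).cx.X i →ₗ[k] (resolutionCx k deg).X j →ₗ[k] (resolutionCx k deg).X l :=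
  resLactAux k deg i j l h

/-- The right action on the resolution. -/
def resRact (i j l : ℤ) (h : i + j = l) :
    (resolutionCx k deg).X i →ₗ[k] (dgAlgebra k deg).cx.X j →ₗ[k] (resolutionCx k deg).X l :=
  resRactAux k deg i j l h

theorem resLact_resMk (i j l : ℤ) (h : i + j = l) (a : (dgAlgebra k deg).cx.X i)
    (x : idealL k deg j) (y : idealR k deg j) (w : idealV k deg (j + 1)) :
    resLact k deg i j l h a (resMk k deg x y w) =
      resMk k deg ⟨(dgAlgebra k deg).mul i j l h a x, mul_mem_idealL h a x.2⟩
        ⟨(dgAlgebra k deg).mul i j l h a y, mul_mem_idealR h a y.2⟩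
        (lmulShift k deg i j l h a w) := rfl

theorem resRact_resMk (i j l : ℤ) (h : i + j = l) (a : (dgAlgebra k deg).cx.X j)
    (x : idealL k deg i) (y : idealR k deg i) (w : idealV k deg (i + 1)) :
    resRact k deg i j l h (resMk k deg x y w) a =
      resMk k deg ⟨(dgAlgebra k deg).mul i j l h x a, mul_mem_idealL' h x.2 a⟩
        ⟨(dgAlgebra k deg).mul i j l h y a, mul_mem_idealR' h y.2 a⟩
        ⟨(dgAlgebra k deg).mul (i + 1) j (l + 1) (by lia) w a, mul_mem_idealV' _ w.2 a⟩ := rfl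

theorem units_smul_resMk {i : ℤ} (u : ℤˣ) (x : idealL k deg i) (y : idealR k deg i)
    (w : idealV k deg (i + 1)) :
    u • resMk k deg x y w = resMk k deg (u • x) (u • y) (u • w) := rfl

/-- The resolution of the diagonal bimodule `Λ`: the cone of the inclusion of `V` into
`Λ e₁ ⊕ e₂ Λ`. Note that `Λ e₁ ≅ Λ e₁ ⊗ e₁ Λ` and `e₂ Λ ≅ Λ e₂ ⊗ e₂ Λ`. -/
noncomputable def resolution : DGBimodule (dgAlgebra k deg) where
  cx := resolutionCx k deg
  lact := resLact k deg
  ract := resRact k deg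
  one_lact i m := by
    induction m using res_induction with | mk x y w =>
    rw [resLact_resMk]
    refine resMk_ext ((dgAlgebra k deg).one_mul _ _) ((dgAlgebra k deg).one_mul _ _) ?_
    rw [coe_lmulShift, Int.negOnePow_zero, one_smul]
    exact (dgAlgebra k deg).one_mul _ _
  ract_one i m := by
    induction m using res_induction with | mk x y w =>
    rw [resRact_resMk]
    exact resMk_ext ((dgAlgebra k deg).mul_one _ _) ((dgAlgebra k deg).mul_one _ _)
      ((dgAlgebra k deg).mul_one _ _)
  lact_assoc i j l ij jl n h₁ h₂ h₃ h₄ a b m := by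
    induction m using res_induction with | mk x y w =>
    rw [resLact_resMk, resLact_resMk, resLact_resMk]
    refine resMk_ext ((dgAlgebra k deg).mul_assoc _ _ _ _ _ _ _ _ _ _ _ _ _)
      ((dgAlgebra k deg).mul_assoc _ _ _ _ _ _ _ _ _ _ _ _ _) ?_
    rw [coe_lmulShift, coe_lmulShift, coe_lmulShift, map_units_smul, smul_smul,
      ← Int.negOnePow_add, h₁, (dgAlgebra k deg).mul_assoc i j (l + 1) ij (jl + 1) (n + 1)]
  ract_assoc i j l ij jl n h₁ h₂ h₃ h₄ m a b := by
    induction m using res_induction with | mk x y w =>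
    rw [resRact_resMk, resRact_resMk, resRact_resMk]
    exact resMk_ext ((dgAlgebra k deg).mul_assoc _ _ _ _ _ _ _ _ _ _ _ _ _)
      ((dgAlgebra k deg).mul_assoc _ _ _ _ _ _ _ _ _ _ _ _ _)
      ((dgAlgebra k deg).mul_assoc _ _ _ _ _ _ _ _ _ _ _ _ _)
  lact_ract i j l ij jl n h₁ h₂ h₃ h₄ a m b := by
    induction m using res_induction with | mk x y w =>
    rw [resLact_resMk, resRact_resMk, resRact_resMk, resLact_resMk]
    refine resMk_ext ((dgAlgebra k deg).mul_assoc _ _ _ _ _ _ _ _ _ _ _ _ _)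
      ((dgAlgebra k deg).mul_assoc _ _ _ _ _ _ _ _ _ _ _ _ _) ?_
    dsimp only
    rw [coe_lmulShift, coe_lmulShift, ← LinearMap.flip_apply, map_units_smul,
      LinearMap.flip_apply, (dgAlgebra k deg).mul_assoc i (j + 1) l (ij + 1) (jl + 1) (n + 1)]
  d_lact i j n i' j' n' hi hj hn h h₁ h₂ a m := by
    induction m using res_induction with | mk x y w =>
    -- The sign in the left action on V[1] is exactly the Leibniz sign.
    have key : castX (dgAlgebra k deg).cx (n + 1) n' (lmulShift k deg i j n h a w).1 =
        i.negOnePow • (dgAlgebra k deg).mul i j' n' h₂ a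
          (castX (dgAlgebra k deg).cx (j + 1) j' w) := by
      rw [coe_lmulShift, map_units_smul]
      exact congrArg _ (castX_mul_left k deg _ h₂ hj a w.1)
    rw [show (dgAlgebra k deg).cx.d i i' a = 0 from rfl, LinearMap.map_zero₂, zero_add,
      resLact_resMk, resolutionCx_d, resolutionCx_d, resLact_resMk, units_smul_resMk]
    refine resMk_ext ?_ ?_ ?_
    · rw [coe_units_smul]
      exact key
    · rw [coe_units_smul]
      dsimp only
      rw [Submodule.coe_neg, Submodule.coe_neg, map_neg, smul_neg]
      exact congrArg _ key
    · rw [map_zero, smul_zero]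
  d_ract i j n i' j' n' hi hj hn h h₁ h₂ m a := by
    induction m using res_induction with | mk x y w =>
    have key : castX (dgAlgebra k deg).cx (n + 1) n' ((dgAlgebra k deg).mul (i + 1) j (n + 1)
        (by lia) w a) =
        (dgAlgebra k deg).mul i' j n' h₁ (castX (dgAlgebra k deg).cx (i + 1) i' w) a :=
      castX_mul_right k deg _ _ hi _ _
    rw [show (dgAlgebra k deg).cx.d j j' a = 0 from rfl, map_zero, smul_zero, add_zero,
      resRact_resMk, resolutionCx_d, resolutionCx_d, resRact_resMk]
    refine resMk_ext key ?_ ?_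
    · dsimp only
      rw [Submodule.coe_neg, Submodule.coe_neg, LinearMap.map_neg₂]
      exact congrArg _ key
    · exact (LinearMap.map_zero₂ _ _).symm

/-- The augmentation of the resolution. -/
noncomputable def augmentation : resolution k deg ⟶ DGBimodule.regular (dgAlgebra k deg) :=
  ⟨{ f := fun i => ModuleCat.ofHom
        (LinearMap.coprod (idealL k deg i).subtype
          ((idealR k deg i).subtype ∘ₗ LinearMap.fst k _ (idealV k deg (i + 1))))
     comm' := fun i j _ => by
      refine ModuleCat.hom_ext (LinearMap.ext fun x => ?_)
      exact (add_neg_cancel (castX (dgAlgebra k deg).cx (i + 1) j x.2.2.1)).symm },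
    fun i j l h a m => (map_add ((dgAlgebra k deg).mul i j l h a) m.1.1 m.2.1.1).symm,
    fun i j l h m a => (LinearMap.map_add₂ ((dgAlgebra k deg).mul i j l h) m.1.1 m.2.1.1 a).symm⟩

theorem augmentation_apply {i : ℤ} (x : idealL k deg i) (y : idealR k deg i)
    (w : idealV k deg (i + 1)) :
    (augmentation k deg).1.f i (resMk k deg x y w) =
      (x : (dgAlgebra k deg).cx.X i) + (y : (dgAlgebra k deg).cx.X i) := rfl

/-- This is exactness of 0 → V → Λe₁ ⊕ e₂Λ → Λ → 0: the two ideals have sum Λ and intersection V. -/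
theorem quasiIso_augmentation :
    DGBimodule.quasiIso (dgAlgebra k deg) (augmentation k deg) := by
  rw [DGBimodule.quasiIso_iff_elements]
  intro i j l hij hjl
  refine ⟨fun y _ => ?_, fun x hx hz => ?_⟩
  · let y' : homogeneous k deg j := y
    -- A decomposition along Λe₁ + e₂Λ is not unique; here the arrows all go into Λe₁.
    refine ⟨resMk k deg ⟨(⟨((y'.1.1.1, 0), y'.1.2), ?_⟩ : homogeneous k deg j), rfl⟩
      ⟨(⟨((0, y'.1.1.2), 0), ?_⟩ : homogeneous k deg j), rfl⟩ 0, ?_, 0, ?_⟩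
    · refine ⟨fun h => ?_, y'.2.2⟩
      rw [y'.2.1 h]
      rfl
    · refine ⟨fun h => ?_, fun _ _ => rfl⟩
      rw [y'.2.1 h]
      rfl
    · refine (resolutionCx_d k deg j l _ _ _).trans ?_
      rw [map_zero, map_zero, neg_zero]
      rfl
    · rw [map_zero, add_zero, augmentation_apply]
      refine toPath_injective j (Prod.ext (Prod.ext ?_ ?_) ?_)
      · exact add_zero y'.1.1.1
      · exact zero_add y'.1.1.2
      · exact add_zero y'.1.2
  · induction x using res_induction with | mk x y w =>
    obtain ⟨z, hz⟩ := hz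
    rw [augmentation_apply] at hz
    have hz' : (x : (dgAlgebra k deg).cx.X j) + (y : (dgAlgebra k deg).cx.X j) = 0 := hz
    -- Since V → Λe₁ is injective, a cycle has no component in V[1].
    have hw : w = 0 := by
      have := congrArg (fun t : idealL k deg l × idealR k deg l × idealV k deg (l + 1) => t.1.1)
        ((resolutionCx_d k deg j l x y w).symm.trans hx)
      have h0 : castX (dgAlgebra k deg).cx (j + 1) l w = 0 := this
      subst hjl
      rw [castX_self] at h0
      exact Subtype.ext h0
    subst hij
    have hxy : (y : (dgAlgebra k deg).cx.X (i + 1)) = -x := (neg_eq_of_add_eq_zero_right hz').symm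
    -- From x = -y it follows that x lies in both ideals; placed in V[1], it bounds the pair (x, y).
    have hxV : (x : (dgAlgebra k deg).cx.X (i + 1)) ∈ idealV k deg (i + 1) := by
      have : -(x : (dgAlgebra k deg).cx.X (i + 1)) ∈ idealR k deg (i + 1) := hxy ▸ y.2
      exact ⟨x.2, neg_mem_iff.1 this⟩
    refine ⟨resMk k deg 0 0 ⟨x, hxV⟩, ?_⟩
    refine Eq.trans ?_ (resolutionCx_d k deg i (i + 1) 0 0 ⟨x, hxV⟩).symm
    refine resMk_ext (castX_self _ _ _).symm (hxy.trans ?_) (congrArg Subtype.val hw)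
    exact congrArg Neg.neg (castX_self _ _ _).symm

end Kronecker

/-! ### Corners e M e' and lifting along quasi-isomorphisms. -/

namespace Kronecker

open CochainComplex

variable {k : Type u} [Field k] {n : ℕ} {deg : Fin n → ℤ}

section corner

variable (M : DGBimodule (dgAlgebra k deg)) (e e' : (dgAlgebra k deg).cx.X 0)

/-- The subspaces `e M e'`. -/
def corner (i : ℤ) : Submodule k (M.cx.X i) where
  carrier := { m | M.lact 0 i i (zero_add i) e m = m ∧ M.ract i 0 i (add_zero i) m e' = m }
  add_mem' hx hy := ⟨by rw [map_add, hx.1, hy.1], by rw [LinearMap.map_add₂, hx.2, hy.2]⟩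
  zero_mem' := ⟨map_zero _, LinearMap.map_zero₂ _ _⟩
  smul_mem' c x hx := ⟨by rw [map_smul, hx.1], by rw [LinearMap.map_smul₂, hx.2]⟩

/-- The projection `m ↦ e m e'`. -/
def cornerProj (i : ℤ) : M.cx.X i →ₗ[k] M.cx.X i :=
  (M.ract i 0 i (add_zero i)).flip e' ∘ₗ M.lact 0 i i (zero_add i) e

variable {M e e'}

theorem cornerProj_of_mem {i : ℤ} {m : M.cx.X i} (hm : m ∈ corner M e e' i) :
    cornerProj M e e' i m = m :=
  (congrArg (fun t => M.ract i 0 i (add_zero i) t e') hm.1).trans hm.2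

theorem cornerProj_mem (he : (dgAlgebra k deg).mul 0 0 0 (add_zero 0) e e = e)
    (he' : (dgAlgebra k deg).mul 0 0 0 (add_zero 0) e' e' = e') {i : ℤ} (m : M.cx.X i) :
    cornerProj M e e' i m ∈ corner M e e' i := by
  change M.ract i 0 i (add_zero i) (M.lact 0 i i (zero_add i) e m) e' ∈ _
  constructor
  · rw [← M.lact_ract 0 i 0 i i i (zero_add i) (add_zero i) (add_zero i) (zero_add i),
      ← M.lact_assoc 0 0 i 0 i i (add_zero 0) (zero_add i) (zero_add i) (zero_add i), he]
  · rw [M.ract_assoc i 0 0 i 0 i (add_zero i) (add_zero 0) (add_zero i) (add_zero i), he']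

theorem d_lact_zero (e : (dgAlgebra k deg).cx.X 0) {i j : ℤ} (m : M.cx.X i) (hij : i + 1 = j) :
    M.cx.d i j (M.lact 0 i i (zero_add i) e m) =
      M.lact 0 j j (zero_add j) e (M.cx.d i j m) := by
  rw [d_lact_of_zero 0 i i j j hij (zero_add i) (zero_add j), Int.negOnePow_zero, one_smul]

/-- Idempotents are cycles of degree 0, so no sign appears. Corners are therefore natural direct
summands of the complex and inherit the lifting properties of a quasi-isomorphism. -/
theorem cornerProj_d {i j : ℤ} (hij : i + 1 = j) (m : M.cx.X i) :
    cornerProj M e e' j (M.cx.d i j m) = M.cx.d i j (cornerProj M e e' i m) := by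
  change M.ract j 0 j (add_zero j) (M.lact 0 j j (zero_add j) e (M.cx.d i j m)) e' =
    M.cx.d i j (M.ract i 0 i (add_zero i) (M.lact 0 i i (zero_add i) e m) e')
  rw [d_ract_of_zero i 0 i j j hij, d_lact_zero e m hij]

theorem map_mem_corner {N : DGBimodule (dgAlgebra k deg)} (s : M ⟶ N) {i : ℤ} {m : M.cx.X i}
    (hm : m ∈ corner M e e' i) : s.1.f i m ∈ corner N e e' i := by
  constructor
  · rw [← s.2.1, hm.1]
  · rw [← s.2.2, hm.2]

theorem map_cornerProj {N : DGBimodule (dgAlgebra k deg)} (s : M ⟶ N) {i : ℤ} (m : M.cx.X i) :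
    s.1.f i (cornerProj M e e' i m) = cornerProj N e e' i (s.1.f i m) := by
  change s.1.f i (M.ract i 0 i (add_zero i) (M.lact 0 i i (zero_add i) e m) e') =
    N.ract i 0 i (add_zero i) (N.lact 0 i i (zero_add i) e (s.1.f i m)) e'
  rw [s.2.2, s.2.1]

end corner

section lifting

variable {M N : DGBimodule (dgAlgebra k deg)} {s : M ⟶ N} {e e' : (dgAlgebra k deg).cx.X 0}

/-- A quasi-isomorphism is surjective on the cohomology of `e M e'`. -/
theorem exists_cycle_lift (hs : DGBimodule.quasiIso (dgAlgebra k deg) s)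
    (he : (dgAlgebra k deg).mul 0 0 0 (add_zero 0) e e = e)
    (he' : (dgAlgebra k deg).mul 0 0 0 (add_zero 0) e' e' = e')
    {i j l : ℤ} (hij : i + 1 = j) (hjl : j + 1 = l) (y : N.cx.X j) (hy : y ∈ corner N e e' j)
    (hd : N.cx.d j l y = 0) :
    ∃ x ∈ corner M e e' j, M.cx.d j l x = 0 ∧
      ∃ w ∈ corner N e e' i, s.1.f j x = y + N.cx.d i j w := by
  obtain ⟨x, hx, w, hw⟩ := ((DGBimodule.quasiIso_iff_elements s).1 hs i j l hij hjl).1 y hd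
  -- Projecting an arbitrary lift onto the corner preserves the equations, since `y` is fixed by the
  -- projection.
  refine ⟨cornerProj M e e' j x, cornerProj_mem he he' x, ?_, cornerProj N e e' i w,
    cornerProj_mem he he' w, ?_⟩
  · rw [← cornerProj_d hjl, hx, map_zero]
  · rw [map_cornerProj, hw, map_add, cornerProj_d hij, cornerProj_of_mem hy]

/-- A quasi-isomorphism is injective on the cohomology of `e M e'`, with control of the
boundaries; the choices can be made linearly. -/
theorem exists_boundary_lift (hs : DGBimodule.quasiIso (dgAlgebra k deg) s)
    (he : (dgAlgebra k deg).mul 0 0 0 (add_zero 0) e e = e)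
    (he' : (dgAlgebra k deg).mul 0 0 0 (add_zero 0) e' e' = e')
    {h i j l : ℤ} (hhi : h + 1 = i) (hij : i + 1 = j) (hjl : j + 1 = l)
    {U : Type u} [AddCommGroup U] [Module k U] (x : U →ₗ[k] M.cx.X j) (y : U →ₗ[k] N.cx.X i)
    (hx : ∀ v, x v ∈ corner M e e' j) (hy : ∀ v, y v ∈ corner N e e' i)
    (hd : ∀ v, M.cx.d j l (x v) = 0) (hxy : ∀ v, s.1.f j (x v) = N.cx.d i j (y v)) :
    ∃ (a : U →ₗ[k] M.cx.X i) (b : U →ₗ[k] N.cx.X h),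
      (∀ v, a v ∈ corner M e e' i) ∧ (∀ v, b v ∈ corner N e e' h) ∧
      (∀ v, x v = M.cx.d i j (a v)) ∧ (∀ v, s.1.f i (a v) = y v + N.cx.d h i (b v)) := by
  -- Both unknowns are encoded in one linear map, up to sign a differential of the cone of `s`;
  -- `key` is acyclicity of that cone.
  let φ : (M.cx.X i × N.cx.X h) →ₗ[k] (M.cx.X j × N.cx.X i) :=
    ((M.cx.d i j).hom ∘ₗ LinearMap.fst k _ _).prod
      ((s.1.f i).hom ∘ₗ LinearMap.fst k _ _ - (N.cx.d h i).hom ∘ₗ LinearMap.snd k _ _)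
  have key (v : U) : x.prod y v ∈ LinearMap.range φ := by
    obtain ⟨c, hc⟩ := ((DGBimodule.quasiIso_iff_elements s).1 hs i j l hij hjl).2 (x v) (hd v)
      ⟨y v, hxy v⟩
    -- The error of a first primitive `c` is a cycle of `N`, which is corrected by a cycle `c'` of
    -- `M` up to a boundary.
    have h1 : N.cx.d i j (s.1.f i c - y v) = 0 := by
      rw [map_sub, ← map_d_apply, ← hc, hxy, sub_self]
    obtain ⟨c', hc', z, hz⟩ :=
      ((DGBimodule.quasiIso_iff_elements s).1 hs h i j hhi hij).1 _ h1
    refine ⟨(c - c', -z), Prod.ext ?_ ?_⟩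
    · change M.cx.d i j (c - c') = x v
      rw [map_sub, hc', sub_zero, hc]
    · change s.1.f i (c - c') - N.cx.d h i (-z) = y v
      rw [map_sub, map_neg, hz]
      abel
  -- Vector spaces are projective, so pointwise solvability yields a linear solution.
  obtain ⟨θ, hθ⟩ := Module.projective_lifting_property φ.rangeRestrict
    ((x.prod y).codRestrict _ key) φ.surjective_rangeRestrict
  have hθ' (v : U) : φ (θ v) = (x v, y v) := congrArg Subtype.val (LinearMap.congr_fun hθ v)
  have h1 (v : U) : M.cx.d i j (θ v).1 = x v := congrArg Prod.fst (hθ' v)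
  have h2 (v : U) : s.1.f i (θ v).1 - N.cx.d h i (θ v).2 = y v := congrArg Prod.snd (hθ' v)
  refine ⟨cornerProj M e e' i ∘ₗ LinearMap.fst k _ _ ∘ₗ θ,
    cornerProj N e e' h ∘ₗ LinearMap.snd k _ _ ∘ₗ θ, fun v => cornerProj_mem he he' _,
    fun v => cornerProj_mem he he' _, fun v => ?_, fun v => ?_⟩
  · change x v = M.cx.d i j (cornerProj M e e' i (θ v).1)
    rw [← cornerProj_d hij, h1, cornerProj_of_mem (hx v)]
  · change s.1.f i (cornerProj M e e' i (θ v).1) =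
      y v + N.cx.d h i (cornerProj N e e' h (θ v).2)
    rw [← cornerProj_d hhi, map_cornerProj, ← sub_eq_iff_eq_add, ← map_sub, h2,
      cornerProj_of_mem (hy v)]

/-- A quasi-isomorphism is injective on the cohomology of `e M e'`, with control of the
boundaries. -/
theorem exists_boundary_lift_apply (hs : DGBimodule.quasiIso (dgAlgebra k deg) s)
    (he : (dgAlgebra k deg).mul 0 0 0 (add_zero 0) e e = e)
    (he' : (dgAlgebra k deg).mul 0 0 0 (add_zero 0) e' e' = e')
    {h i j l : ℤ} (hhi : h + 1 = i) (hij : i + 1 = j) (hjl : j + 1 = l)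
    (x : M.cx.X j) (y : N.cx.X i) (hx : x ∈ corner M e e' j) (hy : y ∈ corner N e e' i)
    (hd : M.cx.d j l x = 0) (hxy : s.1.f j x = N.cx.d i j y) :
    ∃ a ∈ corner M e e' i, ∃ b ∈ corner N e e' h,
      x = M.cx.d i j a ∧ s.1.f i a = y + N.cx.d h i b := by
  -- Single elements are linear maps from a one-dimensional space, evaluated at its generator.
  obtain ⟨a, b, ha, hb, h1, h2⟩ := exists_boundary_lift hs he he' hhi hij hjl
    ((LinearMap.toSpanSingleton k _ x) ∘ₗ (ULift.moduleEquiv : ULift.{u} k ≃ₗ[k] k).toLinearMap)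
    ((LinearMap.toSpanSingleton k _ y) ∘ₗ (ULift.moduleEquiv : ULift.{u} k ≃ₗ[k] k).toLinearMap)
    (fun v => Submodule.smul_mem _ v.down hx) (fun v => Submodule.smul_mem _ v.down hy)
    (fun v => (map_smul (M.cx.d j l).hom v.down x).trans ((congrArg _ hd).trans (smul_zero _)))
    (fun v => (map_smul (s.1.f j).hom v.down x).trans
      ((congrArg (v.down • ·) hxy).trans (map_smul (N.cx.d i j).hom v.down y).symm))
  have hx1 : x = M.cx.d i j (a ⟨1⟩) := (one_smul k x).symm.trans (h1 ⟨1⟩)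
  have hy1 : s.1.f i (a ⟨1⟩) = y + N.cx.d h i (b ⟨1⟩) :=
    (h2 ⟨1⟩).trans (congrArg (· + N.cx.d h i (b ⟨1⟩)) (one_smul k y))
  exact ⟨a ⟨1⟩, ha _, b ⟨1⟩, hb _, hx1, hy1⟩

end lifting

theorem e₁_mul_e₁ :
    (dgAlgebra k deg).mul 0 0 0 (add_zero 0) (e₁ k deg) (e₁ k deg) = e₁ k deg :=
  mul_e₁ e₁_mem_idealL

theorem e₂_mul_e₂ :
    (dgAlgebra k deg).mul 0 0 0 (add_zero 0) (e₂ k deg) (e₂ k deg) = e₂ k deg :=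
  e₂_mul e₂_mem_idealR

/-! ### Morphisms out of the resolution, described by their values on generators. -/

section elements

/-- The elements of the resolution. -/
noncomputable def el {i : ℤ} (l : idealL k deg i) (r : idealR k deg i)
    (w : idealV k deg (i + 1)) : (resolution k deg).cx.X i :=
  resMk k deg l r w

@[elab_as_elim]
theorem el_induction {i : ℤ} {motive : (resolution k deg).cx.X i → Prop}
    (x : (resolution k deg).cx.X i) (mk : ∀ l r w, motive (el l r w)) : motive x :=
  res_induction x mk

theorem el_ext {i : ℤ} {l l' : idealL k deg i} {r r' : idealR k deg i}
    {w w' : idealV k deg (i + 1)} (hl : (l : (dgAlgebra k deg).cx.X i) = l')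
    (hr : (r : (dgAlgebra k deg).cx.X i) = r') (hw : (w : (dgAlgebra k deg).cx.X (i + 1)) = w') :
    el l r w = el l' r' w' :=
  resMk_ext hl hr hw

theorem el_add {i : ℤ} (l l' : idealL k deg i) (r r' : idealR k deg i)
    (w w' : idealV k deg (i + 1)) :
    el l r w + el l' r' w' = el (l + l') (r + r') (w + w') := rfl

theorem d_el (i j : ℤ) (l : idealL k deg i) (r : idealR k deg i) (w : idealV k deg (i + 1)) :
    (resolution k deg).cx.d i j (el l r w) =
      el (inclL k deg (i + 1) j w) (-inclR k deg (i + 1) j w) 0 := rfl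

theorem lact_el (i j l : ℤ) (h : i + j = l) (a : (dgAlgebra k deg).cx.X i)
    (x : idealL k deg j) (y : idealR k deg j) (w : idealV k deg (j + 1)) :
    (resolution k deg).lact i j l h a (el x y w) =
      el ⟨(dgAlgebra k deg).mul i j l h a x, mul_mem_idealL h a x.2⟩
        ⟨(dgAlgebra k deg).mul i j l h a y, mul_mem_idealR h a y.2⟩
        (lmulShift k deg i j l h a w) := rfl

theorem ract_el (i j l : ℤ) (h : i + j = l) (a : (dgAlgebra k deg).cx.X j)
    (x : idealL k deg i) (y : idealR k deg i) (w : idealV k deg (i + 1)) :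
    (resolution k deg).ract i j l h (el x y w) a =
      el ⟨(dgAlgebra k deg).mul i j l h x a, mul_mem_idealL' h x.2 a⟩
        ⟨(dgAlgebra k deg).mul i j l h y a, mul_mem_idealR' h y.2 a⟩
        ⟨(dgAlgebra k deg).mul (i + 1) j (l + 1) (by lia) w a, mul_mem_idealV' _ w.2 a⟩ := rfl

end elements

section hom

variable {M : DGBimodule (dgAlgebra k deg)}

/-- The image of the generator `e₁` under a morphism out of the resolution. -/
noncomputable def x₁ (f : resolution k deg ⟶ M) : M.cx.X 0 :=
  f.1.f 0 (el ⟨e₁ k deg, e₁_mem_idealL⟩ 0 0)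

/-- The image of the generator `e₂` under a morphism out of the resolution. -/
noncomputable def x₂ (f : resolution k deg ⟶ M) : M.cx.X 0 :=
  f.1.f 0 (el 0 ⟨e₂ k deg, e₂_mem_idealR⟩ 0)

variable (k deg) in
/-- The inclusion of `V[1]` into the resolution. -/
noncomputable def inV (i : ℤ) : idealV k deg (i + 1) →ₗ[k] (resolution k deg).cx.X i :=
  LinearMap.inr k (idealL k deg i) (idealR k deg i × idealV k deg (i + 1)) ∘ₗ
    LinearMap.inr k (idealR k deg i) (idealV k deg (i + 1))

/-- The restriction to `V[1]` of a morphism out of the resolution. -/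
noncomputable def yV (f : resolution k deg ⟶ M) (i : ℤ) : idealV k deg (i + 1) →ₗ[k] M.cx.X i :=
  (f.1.f i).hom ∘ₗ inV k deg i

theorem yV_apply (f : resolution k deg ⟶ M) (i : ℤ) (w : idealV k deg (i + 1)) :
    yV f i w = f.1.f i (el 0 0 w) := rfl

/-- Since l = l e₁ and r = e₂ r, left linearity determines `f` on Λe₁ and right linearity determines
it on e₂Λ. -/
theorem hom_apply (f : resolution k deg ⟶ M) (i : ℤ) (l : idealL k deg i) (r : idealR k deg i)
    (w : idealV k deg (i + 1)) :
    f.1.f i (el l r w) = M.lact i 0 i (add_zero i) l (x₁ f) +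
      M.ract 0 i i (zero_add i) (x₂ f) r + yV f i w := by
  have h1 : el l 0 0 = (resolution k deg).lact i 0 i (add_zero i) l
      (el ⟨e₁ k deg, e₁_mem_idealL⟩ 0 0) := by
    rw [lact_el]
    exact el_ext (mul_e₁ l.2).symm (map_zero _).symm
      (congrArg Subtype.val (map_zero (lmulShift k deg i 0 i (add_zero i) l)).symm)
  have h2 : el 0 r 0 = (resolution k deg).ract 0 i i (zero_add i)
      (el 0 ⟨e₂ k deg, e₂_mem_idealR⟩ 0) r := by
    rw [ract_el]
    exact el_ext (LinearMap.map_zero₂ _ _).symm (e₂_mul r.2).symm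
      (LinearMap.map_zero₂ _ _).symm
  have h3 : el l r w = el l 0 0 + el 0 r 0 + el 0 0 w :=
    by rw [el_add, el_add]; simp
  rw [h3, map_add, map_add]
  refine congrArg₂ _ (congrArg₂ _ ?_ ?_) rfl
  · rw [h1]
    exact f.2.1 i 0 i (add_zero i) l _
  · rw [h2]
    exact f.2.2 0 i i (zero_add i) _ r

theorem hom_ext_resolution {f g : resolution k deg ⟶ M} (h₁ : x₁ f = x₁ g) (h₂ : x₂ f = x₂ g)
    (hy : ∀ i w, yV f i w = yV g i w) : f = g := by
  refine Subtype.ext (HomologicalComplex.hom_ext _ _ fun i =>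
    ModuleCat.hom_ext (LinearMap.ext fun x => ?_))
  induction x using el_induction with | mk l r w =>
  change f.1.f i (el l r w) = g.1.f i (el l r w)
  rw [hom_apply, hom_apply, h₁, h₂, hy]

theorem x₁_mem (f : resolution k deg ⟶ M) : x₁ f ∈ corner M (e₁ k deg) (e₁ k deg) 0 := by
  refine map_mem_corner f ⟨?_, ?_⟩
  · refine (lact_el 0 0 0 (zero_add 0) _ _ _ _).trans (el_ext e₁_mul_e₁ ?_ ?_)
    · exact map_zero _
    · exact congrArg Subtype.val (map_zero (lmulShift k deg 0 0 0 _ _))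
  · refine (ract_el 0 0 0 (zero_add 0) _ _ _ _).trans (el_ext e₁_mul_e₁ ?_ ?_)
    · exact LinearMap.map_zero₂ _ _
    · exact LinearMap.map_zero₂ _ _

theorem x₂_mem (f : resolution k deg ⟶ M) : x₂ f ∈ corner M (e₂ k deg) (e₂ k deg) 0 := by
  refine map_mem_corner f ⟨?_, ?_⟩
  · refine (lact_el 0 0 0 (zero_add 0) _ _ _ _).trans (el_ext ?_ e₂_mul_e₂ ?_)
    · exact map_zero _
    · exact congrArg Subtype.val (map_zero (lmulShift k deg 0 0 0 _ _))
  · refine (ract_el 0 0 0 (zero_add 0) _ _ _ _).trans (el_ext ?_ e₂_mul_e₂ ?_)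
    · exact LinearMap.map_zero₂ _ _
    · exact LinearMap.map_zero₂ _ _

theorem yV_mem (f : resolution k deg ⟶ M) (i : ℤ) (w : idealV k deg (i + 1)) :
    yV f i w ∈ corner M (e₂ k deg) (e₁ k deg) i := by
  refine map_mem_corner f ⟨?_, ?_⟩
  · refine (lact_el 0 i i (zero_add i) _ _ _ _).trans (el_ext ?_ ?_ ?_)
    · exact map_zero _
    · exact map_zero _
    · rw [coe_lmulShift, Int.negOnePow_zero, one_smul]
      exact e₂_mul w.2.2
  · refine (ract_el i 0 i (add_zero i) _ _ _ _).trans (el_ext ?_ ?_ ?_)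
    · exact LinearMap.map_zero₂ _ _
    · exact LinearMap.map_zero₂ _ _
    · exact mul_e₁ w.2.1

theorem d_x₁ (f : resolution k deg ⟶ M) (j : ℤ) : M.cx.d 0 j (x₁ f) = 0 := by
  rw [x₁, ← map_d_apply f.1]
  have : (resolution k deg).cx.d 0 j (el ⟨e₁ k deg, e₁_mem_idealL⟩ 0 0) = 0 :=
    (d_el 0 j _ _ _).trans (el_ext (map_zero (castX _ _ _))
      (neg_eq_zero.2 (map_zero (castX _ _ _))) rfl)
  rw [this, map_zero]

theorem d_x₂ (f : resolution k deg ⟶ M) (j : ℤ) : M.cx.d 0 j (x₂ f) = 0 := by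
  rw [x₂, ← map_d_apply f.1]
  have : (resolution k deg).cx.d 0 j (el 0 ⟨e₂ k deg, e₂_mem_idealR⟩ 0) = 0 :=
    (d_el 0 j _ _ _).trans (el_ext (map_zero (castX _ _ _))
      (neg_eq_zero.2 (map_zero (castX _ _ _))) rfl)
  rw [this, map_zero]

/-- Apply `f` to the boundary (w, -w) of an element of V[1]. -/
theorem d_yV (f : resolution k deg ⟶ M) (i : ℤ) (w : idealV k deg (i + 1)) :
    M.cx.d i (i + 1) (yV f i w) = M.lact (i + 1) 0 (i + 1) (add_zero _) w (x₁ f) -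
      M.ract 0 (i + 1) (i + 1) (zero_add _) (x₂ f) w := by
  rw [yV_apply, ← map_d_apply f.1]
  have h : (resolution k deg).cx.d i (i + 1) (el 0 0 w) =
      el ⟨w, w.2.1⟩ (-⟨w, w.2.2⟩) 0 :=
    (d_el i (i + 1) _ _ _).trans (el_ext (castX_self _ _ _)
      (congrArg Neg.neg (castX_self _ _ _)) rfl)
  rw [h, hom_apply, map_zero, add_zero, Submodule.coe_neg, map_neg, ← sub_eq_add_neg]

/-- The morphism out of the resolution with given values on the generators. -/
noncomputable def homMk (a b : M.cx.X 0) (Y : ∀ i, idealV k deg (i + 1) →ₗ[k] M.cx.X i)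
    (ha : a ∈ corner M (e₁ k deg) (e₁ k deg) 0) (hb : b ∈ corner M (e₂ k deg) (e₂ k deg) 0)
    (hY : ∀ i w, Y i w ∈ corner M (e₂ k deg) (e₁ k deg) i)
    (hda : M.cx.d 0 1 a = 0) (hdb : M.cx.d 0 1 b = 0)
    (hdY : ∀ i w, M.cx.d i (i + 1) (Y i w) = M.lact (i + 1) 0 (i + 1) (add_zero _) w a -
      M.ract 0 (i + 1) (i + 1) (zero_add _) b w) :
    resolution k deg ⟶ M :=
  ⟨{ f := fun i => ModuleCat.ofHom (X := idealL k deg i × idealR k deg i × idealV k deg (i + 1))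
        (LinearMap.coprod ((M.lact i 0 i (add_zero i)).flip a ∘ₗ (idealL k deg i).subtype)
          (LinearMap.coprod (M.ract 0 i i (zero_add i) b ∘ₗ (idealR k deg i).subtype) (Y i)))
     comm' := fun i j hij => by
      obtain rfl : i + 1 = j := hij
      refine ModuleCat.hom_ext (LinearMap.ext fun x => ?_)
      induction x using el_induction with | mk l r w =>
      change M.cx.d i (i + 1) (M.lact i 0 i (add_zero i) l a +
        (M.ract 0 i i (zero_add i) b r + Y i w)) =
        M.lact (i + 1) 0 (i + 1) (add_zero _) (castX (dgAlgebra k deg).cx (i + 1) (i + 1) w) a +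
        (M.ract 0 (i + 1) (i + 1) (zero_add _)
          b (-(castX (dgAlgebra k deg).cx (i + 1) (i + 1) w)) + Y (i + 1) 0)
      rw [castX_self, map_zero, add_zero, map_neg, map_add, map_add, hdY,
        d_lact_of_zero i 0 i 1 (i + 1) rfl _ rfl, hda, map_zero, smul_zero,
        d_ract_of_zero 0 i i 1 (i + 1) rfl _ (by lia), hdb, LinearMap.map_zero₂, zero_add,
        zero_add, ← sub_eq_add_neg] },
    fun i j l h c m => by
      induction m using el_induction with | mk x y w =>
      change M.lact l 0 l (add_zero l) ((dgAlgebra k deg).mul i j l h c x) a +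
        (M.ract 0 l l (zero_add l) b ((dgAlgebra k deg).mul i j l h c y) +
          Y l (lmulShift k deg i j l h c w)) =
        M.lact i j l h c (M.lact j 0 j (add_zero j) x a +
          (M.ract 0 j j (zero_add j) b y + Y j w))
      rw [map_add, map_add]
      refine congrArg₂ _ ?_ (congrArg₂ _ ?_ ?_)
      · exact M.lact_assoc i j 0 l j l h (add_zero j) (add_zero l) h c x a
      -- Left linearity on e₂Λ holds because Λ acts on the left of both b and r through the
      -- e₂-coefficient.
      · rw [← M.lact_ract i 0 j i j l (add_zero i) (zero_add j) h h, lact_eq_smul hb.1,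
          mul_eq_smul' y.2, map_smul, LinearMap.map_smul₂]
        by_cases hi : i = 0
        · subst hi
          obtain rfl : j = l := by lia
          rw [castX_self, castX_self]
        · rw [castX_of_ne _ (by lia), castX_of_ne _ (Ne.symm hi), map_zero,
            LinearMap.map_zero₂]
      -- The sign of V[1] is harmless: for i = 0 it is 1, and for i ≠ 0 both sides vanish. Thus bare
      -- linearity of `Y` suffices.
      · rw [lact_eq_smul (hY j w).1]
        by_cases hi : i = 0
        · subst hi
          obtain rfl : j = l := by lia
          rw [castX_self, ← map_smul]
          congr 1
          refine Subtype.ext ?_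
          rw [coe_lmulShift, Int.negOnePow_zero, one_smul, mul_eq_smul' w.2.2, castX_self]
          rfl
        · rw [castX_of_ne _ (by lia), smul_zero]
          have : lmulShift k deg i j l h c w = 0 := by
            refine Subtype.ext ?_
            rw [coe_lmulShift, mul_eq_smul' w.2.2, castX_of_ne _ (by lia), smul_zero, smul_zero]
            rfl
          rw [this, map_zero],
    fun i j l h m c => by
      induction m using el_induction with | mk x y w =>
      change M.lact l 0 l (add_zero l) ((dgAlgebra k deg).mul i j l h x c) a +
        (M.ract 0 l l (zero_add l) b ((dgAlgebra k deg).mul i j l h y c) +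
          Y l ⟨(dgAlgebra k deg).mul (i + 1) j (l + 1) (by lia) w c, mul_mem_idealV' _ w.2 c⟩) =
        M.ract i j l h (M.lact i 0 i (add_zero i) x a +
          (M.ract 0 i i (zero_add i) b y + Y i w)) c
      rw [LinearMap.map_add₂, LinearMap.map_add₂]
      refine congrArg₂ _ ?_ (congrArg₂ _ ?_ ?_)
      -- Dually, Λ acts on the right of both x and a through the e₁-coefficient.
      · rw [M.lact_ract i 0 j i j l (add_zero i) (zero_add j) h h, ract_eq_smul ha.2,
          mul_eq_smul x.2, map_smul, LinearMap.smul_apply, map_smul]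
        by_cases hj : j = 0
        · subst hj
          obtain rfl : i = l := by lia
          rw [castX_self, castX_self]
        · rw [castX_of_ne _ (by lia), castX_of_ne _ (Ne.symm hj), map_zero, map_zero,
            LinearMap.zero_apply]
      · exact (M.ract_assoc 0 i j i l l (zero_add i) h h (zero_add l) b y c).symm
      · rw [ract_eq_smul (hY i w).2]
        by_cases hj : j = 0
        · subst hj
          obtain rfl : i = l := by lia
          rw [castX_self, ← map_smul]
          congr 1
          refine Subtype.ext ?_
          dsimp only
          rw [mul_eq_smul w.2.1, castX_self]
          rfl
        · rw [castX_of_ne _ (by lia), smul_zero]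
          refine (congrArg (Y l) (Subtype.ext ?_)).trans (map_zero (Y l))
          dsimp only
          rw [mul_eq_smul w.2.1, castX_of_ne _ (by lia), smul_zero]
          rfl⟩

section homMk

variable {a b : M.cx.X 0} {Y : ∀ i, idealV k deg (i + 1) →ₗ[k] M.cx.X i}
    (ha : a ∈ corner M (e₁ k deg) (e₁ k deg) 0) (hb : b ∈ corner M (e₂ k deg) (e₂ k deg) 0)
    (hY : ∀ i w, Y i w ∈ corner M (e₂ k deg) (e₁ k deg) i)
    (hda : M.cx.d 0 1 a = 0) (hdb : M.cx.d 0 1 b = 0)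
    (hdY : ∀ i w, M.cx.d i (i + 1) (Y i w) = M.lact (i + 1) 0 (i + 1) (add_zero _) w a -
      M.ract 0 (i + 1) (i + 1) (zero_add _) b w)

theorem homMk_apply (i : ℤ) (l : idealL k deg i) (r : idealR k deg i)
    (w : idealV k deg (i + 1)) :
    (homMk a b Y ha hb hY hda hdb hdY).1.f i (el l r w) =
      M.lact i 0 i (add_zero i) l a + (M.ract 0 i i (zero_add i) b r + Y i w) := rfl

theorem x₁_homMk : x₁ (homMk a b Y ha hb hY hda hdb hdY) = a := by
  refine (homMk_apply ha hb hY hda hdb hdY _ _ _ _).trans ?_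
  rw [map_zero, add_zero]
  refine (congrArg _ (map_zero _)).trans ?_
  rw [add_zero]
  exact ha.1

theorem x₂_homMk : x₂ (homMk a b Y ha hb hY hda hdb hdY) = b := by
  refine (homMk_apply ha hb hY hda hdb hdY _ _ _ _).trans ?_
  rw [map_zero, add_zero]
  refine (congrArg (· + _) (LinearMap.map_zero₂ _ _)).trans ?_
  rw [zero_add]
  exact hb.2

theorem yV_homMk (i : ℤ) (w : idealV k deg (i + 1)) :
    yV (homMk a b Y ha hb hY hda hdb hdY) i w = Y i w := by
  refine (homMk_apply ha hb hY hda hdb hdY _ _ _ _).trans ?_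
  refine (congrArg₂ _ (LinearMap.map_zero₂ _ _) (congrArg (· + _) (map_zero _))).trans ?_
  rw [zero_add, zero_add]
  rfl

end homMk

end hom

end Kronecker

/-! ### Null-homotopies on generators, and homotopical projectivity of the resolution. -/

theorem CochainComplex.castX_injective {k : Type u} [Field k]
    (M : CochainComplex (ModuleCat.{u} k) ℤ) {i j : ℤ} (h : i = j) :
    Function.Injective (CochainComplex.castX M i j) := by
  subst h
  intro x y hxy
  simpa using hxy

namespace DGBimodule

open CochainComplex

variable {k : Type u} [Field k] {A : DGAlgebra k} (M : DGBimodule A)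

/-- The elements of the contractible dg bimodule over `M`. -/
noncomputable def pathMk {i : ℤ} (a : M.cx.X i) (c : M.cx.X (i - 1)) : (pathOver M).cx.X i :=
  ((a, c) : M.cx.X i × M.cx.X (i - 1))

/-- Collecting the second component under one `castX` lets identities be checked in degree `i`, as
`castX` is injective there. -/
theorem pathOver_d {i j : ℤ} (hij : i + 1 = j) (a : M.cx.X i) (c : M.cx.X (i - 1)) :
    (pathOver M).cx.d i j (pathMk M a c) =
      pathMk M (M.cx.d i j a) (castX M.cx i (j - 1) (a - M.cx.d (i - 1) i c)) := by
  refine Prod.ext rfl ?_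
  change castX M.cx i (j - 1) a - M.cx.d (i - 1) (j - 1) c =
    castX M.cx i (j - 1) (a - M.cx.d (i - 1) i c)
  obtain rfl : j - 1 = i := by lia
  rw [castX_self, castX_self]

theorem pathOver_lact {i j l : ℤ} (h : i + j = l) (x : A.cx.X i) (a : M.cx.X j)
    (c : M.cx.X (j - 1)) :
    (pathOver M).lact i j l h x (pathMk M a c) =
      pathMk M (M.lact i j l h x a)
        (i.negOnePow • M.lact i (j - 1) (l - 1) (by lia) x c) := rfl

theorem pathOver_ract {i j l : ℤ} (h : i + j = l) (a : M.cx.X i) (c : M.cx.X (i - 1))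
    (x : A.cx.X j) :
    (pathOver M).ract i j l h (pathMk M a c) x =
      pathMk M (M.ract i j l h a x) (M.ract (i - 1) j (l - 1) (by lia) c x) := rfl

theorem pathMk_sub {i : ℤ} (a a' : M.cx.X i) (c c' : M.cx.X (i - 1)) :
    pathMk M a c - pathMk M a' c' = pathMk M (a - a') (c - c') := rfl

end DGBimodule

namespace Kronecker

open CochainComplex DGBimodule

variable {k : Type u} [Field k] {n : ℕ} {deg : Fin n → ℤ} {M : DGBimodule (dgAlgebra k deg)}

theorem pathMk_mem_corner {e e' : (dgAlgebra k deg).cx.X 0} {i : ℤ} {a : M.cx.X i}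
    {c : M.cx.X (i - 1)} :
    pathMk M a c ∈ corner (pathOver M) e e' i ↔
      a ∈ corner M e e' i ∧ c ∈ corner M e e' (i - 1) := by
  constructor
  · rintro ⟨h1, h2⟩
    rw [pathOver_lact, Int.negOnePow_zero, one_smul] at h1
    rw [pathOver_ract] at h2
    exact ⟨⟨congrArg Prod.fst h1, congrArg Prod.fst h2⟩,
      ⟨congrArg Prod.snd h1, congrArg Prod.snd h2⟩⟩
  · rintro ⟨⟨h1, h2⟩, ⟨h3, h4⟩⟩
    constructor
    · rw [pathOver_lact, Int.negOnePow_zero, one_smul, h1, h3]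
    · rw [pathOver_ract, h2, h4]

/-- Null-homotopic morphisms out of the resolution, in terms of their values on generators. -/
theorem mem_nullHomotopic_iff (f : resolution k deg ⟶ M) :
    f ∈ nullHomotopic (resolution k deg) M ↔
      ∃ c₁ ∈ corner M (e₁ k deg) (e₁ k deg) (0 - 1), ∃ c₂ ∈ corner M (e₂ k deg) (e₂ k deg) (0 - 1),
      ∃ Z : ∀ i, idealV k deg (i + 1) →ₗ[k] M.cx.X (i - 1),
        (∀ i w, Z i w ∈ corner M (e₂ k deg) (e₁ k deg) (i - 1)) ∧
        x₁ f = M.cx.d (0 - 1) 0 c₁ ∧ x₂ f = M.cx.d (0 - 1) 0 c₂ ∧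
        ∀ i w, yV f i w = M.cx.d (i - 1) i (Z i w) +
          ((i + 1).negOnePow • M.lact (i + 1) (0 - 1) i (by lia) w c₁ -
            M.ract (0 - 1) (i + 1) i (by lia) c₂ w) := by
  constructor
  · rintro ⟨g, rfl⟩
    -- Values of `g` are pairs: a value of the given morphism and a component of the homotopy. The
    -- conditions on `g` are read off componentwise.
    have e1 : x₁ g = pathMk M (x₁ (g ≫ pathOverFst M)) (x₁ g).2 := rfl
    have e2 : x₂ g = pathMk M (x₂ (g ≫ pathOverFst M)) (x₂ g).2 := rfl
    let Z : ∀ i, idealV k deg (i + 1) →ₗ[k] M.cx.X (i - 1) := fun i =>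
      LinearMap.snd k (M.cx.X i) (M.cx.X (i - 1)) ∘ₗ yV g i
    have e3 (i w) : yV g i w = pathMk M (yV (g ≫ pathOverFst M) i w) (Z i w) := rfl
    have m1 := x₁_mem g
    have m2 := x₂_mem g
    have m3 := yV_mem g
    have d1 := d_x₁ g 1
    have d2 := d_x₂ g 1
    have d3 := d_yV g
    change ∃ c₁ ∈ corner M (e₁ k deg) (e₁ k deg) (0 - 1),
      ∃ c₂ ∈ corner M (e₂ k deg) (e₂ k deg) (0 - 1),
      ∃ Z : ∀ i, idealV k deg (i + 1) →ₗ[k] M.cx.X (i - 1),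
        (∀ i w, Z i w ∈ corner M (e₂ k deg) (e₁ k deg) (i - 1)) ∧
        x₁ (g ≫ pathOverFst M) = M.cx.d (0 - 1) 0 c₁ ∧
        x₂ (g ≫ pathOverFst M) = M.cx.d (0 - 1) 0 c₂ ∧
        ∀ i w, yV (g ≫ pathOverFst M) i w = M.cx.d (i - 1) i (Z i w) +
          ((i + 1).negOnePow • M.lact (i + 1) (0 - 1) i (by lia) w c₁ -
            M.ract (0 - 1) (i + 1) i (by lia) c₂ w)
    generalize (x₁ g).2 = c₁ at e1
    generalize (x₂ g).2 = c₂ at e2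
    generalize Z = Z at e3 ⊢
    generalize g ≫ pathOverFst M = f at *
    rw [e1] at m1 d1
    rw [e2] at m2 d2
    rw [pathOver_d M (by lia)] at d1 d2
    refine ⟨c₁, (pathMk_mem_corner.1 m1).2, c₂, (pathMk_mem_corner.1 m2).2, Z, fun i w => ?_,
      ?_, ?_, fun i w => ?_⟩
    · have := m3 i w
      rw [e3] at this
      exact (pathMk_mem_corner.1 this).2
    · have := congrArg Prod.snd d1
      exact sub_eq_zero.1 (castX_injective M.cx (by lia) (this.trans (map_zero _).symm))
    · have := congrArg Prod.snd d2
      exact sub_eq_zero.1 (castX_injective M.cx (by lia) (this.trans (map_zero _).symm))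
    -- The second component of `d_yV` for `g` is the homotopy identity; its sign is that of the left
    -- action on the second factor of `pathOver M`.
    · have := d3 i w
      rw [e3, e1, e2, pathOver_d M rfl, pathOver_lact, pathOver_ract, pathMk_sub] at this
      have := congrArg Prod.snd this
      rw [← sub_eq_iff_eq_add']
      refine castX_injective M.cx (by lia : i = i + 1 - 1) (this.trans ?_)
      rw [map_sub, map_units_smul, castX_lact M _ (by lia : i + 1 + (0 - 1) = i + 1 - 1) rfl,
        castX_ract M _ (by lia : 0 - 1 + (i + 1) = i + 1 - 1) rfl, castX_self, castX_self]
      rfl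
  · rintro ⟨c₁, h1, c₂, h2, Z, hZ, hx₁, hx₂, hy⟩
    let Y : ∀ i, idealV k deg (i + 1) →ₗ[k] (pathOver M).cx.X i := fun i => (yV f i).prod (Z i)
    have eY (i w) : Y i w = pathMk M (yV f i w) (Z i w) := rfl
    -- Given that x₁ is a cycle, the pair is a cycle exactly when x₁ = d c₁.
    have hd1 : (pathOver M).cx.d 0 1 (pathMk M (x₁ f) c₁) = 0 := by
      rw [pathOver_d M (by lia), ← hx₁, d_x₁]
      exact Prod.ext rfl ((congrArg _ (sub_self _)).trans (map_zero (castX M.cx 0 (1 - 1))))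
    have hd2 : (pathOver M).cx.d 0 1 (pathMk M (x₂ f) c₂) = 0 := by
      rw [pathOver_d M (by lia), ← hx₂, d_x₂]
      exact Prod.ext rfl ((congrArg _ (sub_self _)).trans (map_zero (castX M.cx 0 (1 - 1))))
    have hY : ∀ i w, Y i w ∈ corner (pathOver M) (e₂ k deg) (e₁ k deg) i := fun i w => by
      rw [eY]
      exact pathMk_mem_corner.2 ⟨yV_mem f i w, hZ i w⟩
    have hdY : ∀ i w, (pathOver M).cx.d i (i + 1) (Y i w) =
        (pathOver M).lact (i + 1) 0 (i + 1) (add_zero _) w (pathMk M (x₁ f) c₁) -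
        (pathOver M).ract 0 (i + 1) (i + 1) (zero_add _) (pathMk M (x₂ f) c₂) w := fun i w => by
      rw [eY, pathOver_d M rfl, pathOver_lact, pathOver_ract, pathMk_sub, d_yV, hy,
        add_sub_cancel_left, map_sub, map_units_smul,
        castX_lact M _ (by lia : i + 1 + (0 - 1) = i + 1 - 1) rfl,
        castX_ract M _ (by lia : 0 - 1 + (i + 1) = i + 1 - 1) rfl, castX_self, castX_self]
    refine ⟨homMk (pathMk M (x₁ f) c₁) (pathMk M (x₂ f) c₂) Y
      (pathMk_mem_corner.2 ⟨x₁_mem f, h1⟩) (pathMk_mem_corner.2 ⟨x₂_mem f, h2⟩) hY hd1 hd2 hdY, ?_⟩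
    refine hom_ext_resolution ?_ ?_ fun i w => ?_
    · exact congrArg Prod.fst (x₁_homMk (pathMk_mem_corner.2 ⟨x₁_mem f, h1⟩)
        (pathMk_mem_corner.2 ⟨x₂_mem f, h2⟩) hY hd1 hd2 hdY)
    · exact congrArg Prod.fst (x₂_homMk (pathMk_mem_corner.2 ⟨x₁_mem f, h1⟩)
        (pathMk_mem_corner.2 ⟨x₂_mem f, h2⟩) hY hd1 hd2 hdY)
    · exact congrArg Prod.fst (yV_homMk (pathMk_mem_corner.2 ⟨x₁_mem f, h1⟩)
        (pathMk_mem_corner.2 ⟨x₂_mem f, h2⟩) hY hd1 hd2 hdY i w)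

theorem lact_mem_corner {i j l : ℤ} (h : i + j = l) (w : idealV k deg i) {m : M.cx.X j}
    (hm : m ∈ corner M (e₁ k deg) (e₁ k deg) j) :
    M.lact i j l h w m ∈ corner M (e₂ k deg) (e₁ k deg) l := by
  constructor
  · rw [← M.lact_assoc 0 i j i l l (zero_add i) h h (zero_add l), e₂_mul w.2.2]
  · rw [M.lact_ract i j 0 l j l h (add_zero j) (add_zero l) h, hm.2]

theorem ract_mem_corner {i j l : ℤ} (h : i + j = l) (w : idealV k deg j) {m : M.cx.X i}
    (hm : m ∈ corner M (e₂ k deg) (e₂ k deg) i) :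
    M.ract i j l h m w ∈ corner M (e₂ k deg) (e₁ k deg) l := by
  constructor
  · rw [← M.lact_ract 0 i j i l l (zero_add i) h h (zero_add l), hm.1]
  · rw [M.ract_assoc i j 0 l j l h (add_zero j) (add_zero l) h, mul_e₁ w.2.1]

/-- The map `w ↦ w a - b w`. -/
def commutator (i j l : ℤ) (h : i + j = l) (h' : j + i = l) (u : ℤˣ) (a b : M.cx.X j) :
    idealV k deg i →ₗ[k] M.cx.X l :=
  (u • (M.lact i j l h).flip a - M.ract j i l h' b) ∘ₗ (idealV k deg i).subtype

theorem commutator_apply (i j l : ℤ) (h : i + j = l) (h' : j + i = l) (u : ℤˣ) (a b : M.cx.X j)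
    (w : idealV k deg i) :
    commutator i j l h h' u a b w = u • M.lact i j l h w a - M.ract j i l h' b w := rfl

theorem units_smul_mem {V : Type*} [AddCommGroup V] [Module k V] (S : Submodule k V) (u : ℤˣ)
    {x : V} (hx : x ∈ S) : u • x ∈ S := by
  rcases Int.units_eq_one_or u with rfl | rfl
  · rwa [one_smul]
  · rw [Units.neg_smul, one_smul]
    exact neg_mem hx

theorem commutator_mem_corner (i j l : ℤ) (h : i + j = l) (h' : j + i = l) (u : ℤˣ)
    {a b : M.cx.X j} (ha : a ∈ corner M (e₁ k deg) (e₁ k deg) j)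
    (hb : b ∈ corner M (e₂ k deg) (e₂ k deg) j) (w : idealV k deg i) :
    commutator i j l h h' u a b w ∈ corner M (e₂ k deg) (e₁ k deg) l :=
  sub_mem (units_smul_mem _ u (lact_mem_corner h w ha)) (ract_mem_corner h' w hb)

/-- Elements of Λ are cycles, so d only acquires the sign of w when passing it on the left. This is
why `commutator` carries the parameter `u`. -/
theorem d_commutator (i j l j' l' : ℤ) (h : i + j = l) (h' : j + i = l) (hj : j + 1 = j')
    (h₁ : i + j' = l') (h₁' : j' + i = l') (u : ℤˣ) (a b : M.cx.X j) (w : idealV k deg i) :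
    M.cx.d l l' (commutator i j l h h' u a b w) =
      commutator i j' l' h₁ h₁' (u * i.negOnePow) (M.cx.d j j' a) (M.cx.d j j' b) w := by
  rw [commutator_apply, commutator_apply, map_sub, map_units_smul,
    d_lact_of_zero i j l j' l' hj h h₁, d_ract_of_zero j i l j' l' hj h' h₁', smul_smul]

theorem map_commutator {N : DGBimodule (dgAlgebra k deg)} (s : M ⟶ N) (i j l : ℤ)
    (h : i + j = l) (h' : j + i = l) (u : ℤˣ) (a b : M.cx.X j) (w : idealV k deg i) :
    s.1.f l (commutator i j l h h' u a b w) =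
      commutator i j l h h' u (s.1.f j a) (s.1.f j b) w := by
  rw [commutator_apply, commutator_apply, map_sub, map_units_smul, s.2.1, s.2.2]

theorem commutator_add (i j l : ℤ) (h : i + j = l) (h' : j + i = l) (u : ℤˣ)
    (a b a' b' : M.cx.X j) (w : idealV k deg i) :
    commutator i j l h h' u (a + a') (b + b') w =
      commutator i j l h h' u a b w + commutator i j l h h' u a' b' w := by
  simp only [commutator_apply, map_add, LinearMap.add_apply, smul_add]
  abel

/-- Lifting proceeds along the filtration of P: first the generators e₁ and e₂ in diagonal corners,
then V[1] in the corner e₂Me₁, where the choices already made enter as commutators. -/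
theorem isHProjective_resolution : IsHProjective (resolution k deg) where
  exists_lift {M N} s hs f := by
    obtain ⟨a, ha, hda, c₁, hc₁, hac⟩ := exists_cycle_lift hs e₁_mul_e₁ e₁_mul_e₁
      (by lia : (0 - 1 : ℤ) + 1 = 0) (by lia : (0 : ℤ) + 1 = 1) (x₁ f) (x₁_mem f) (d_x₁ f 1)
    obtain ⟨b, hb, hdb, c₂, hc₂, hbc⟩ := exists_cycle_lift hs e₂_mul_e₂ e₂_mul_e₂
      (by lia : (0 - 1 : ℤ) + 1 = 0) (by lia : (0 : ℤ) + 1 = 1) (x₂ f) (x₂_mem f) (d_x₂ f 1)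
    -- The cycle w a - b w becomes a boundary in `N`, by the relation for `f` corrected by c₁ and
    -- c₂. Lifting its primitive gives `Y`, and the error is the homotopy `Z`.
    have key (i : ℤ) := exists_boundary_lift hs e₂_mul_e₂ e₁_mul_e₁
      (by lia : i - 1 + 1 = i) (rfl : i + 1 = i + 1) (rfl : i + 1 + 1 = i + 1 + 1)
      (commutator (i + 1) 0 (i + 1) (add_zero _) (zero_add _) 1 a b)
      (yV f i + commutator (i + 1) (0 - 1) i (by lia) (by lia) (i + 1).negOnePow c₁ c₂)
      (commutator_mem_corner _ _ _ _ _ _ ha hb)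
      (fun w => add_mem (yV_mem f i w) (commutator_mem_corner _ _ _ _ _ _ hc₁ hc₂ w))
      (fun w => by
        rw [d_commutator (i + 1) 0 (i + 1) 1 (i + 1 + 1) _ _ (by lia) (by lia) (by lia), hda, hdb,
          commutator_apply, map_zero, LinearMap.map_zero₂, smul_zero, sub_zero])
      (fun w => by
        rw [map_commutator, hac, hbc, commutator_add, LinearMap.add_apply, map_add, d_yV,
          d_commutator (i + 1) (0 - 1) i 0 (i + 1) _ _ (by lia) (by lia) (by lia),
          Int.units_mul_self, commutator_apply (u := 1) (a := x₁ f), one_smul])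
    choose Y Z hY hZ hdY hYZ using key
    have hdY' : ∀ i w, M.cx.d i (i + 1) (Y i w) =
        M.lact (i + 1) 0 (i + 1) (add_zero _) w a -
          M.ract 0 (i + 1) (i + 1) (zero_add _) b w := fun i w => by
      rw [← hdY, commutator_apply, one_smul]
    refine ⟨homMk a b Y ha hb hY hda hdb hdY', ?_⟩
    rw [mem_nullHomotopic_iff]
    refine ⟨c₁, hc₁, c₂, hc₂, Z, hZ, ?_, ?_, fun i w => ?_⟩
    · change s.1.f 0 (x₁ (homMk a b Y ha hb hY hda hdb hdY')) - x₁ f = _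
      rw [x₁_homMk, hac, add_sub_cancel_left]
    · change s.1.f 0 (x₂ (homMk a b Y ha hb hY hda hdb hdY')) - x₂ f = _
      rw [x₂_homMk, hbc, add_sub_cancel_left]
    · change s.1.f i (yV (homMk a b Y ha hb hY hda hdb hdY') i w) - yV f i w = _
      rw [yV_homMk, hYZ, LinearMap.add_apply, commutator_apply]
      abel
  mem_nullHomotopic {M N} s hs f hf := by
    rw [mem_nullHomotopic_iff] at hf ⊢
    obtain ⟨c₁', h₁, c₂', h₂, Z', hZ', hx₁, hx₂, hy⟩ := hf
    -- The homotopy in `N` lifts to `M` only up to the boundaries of b₁ and b₂, which must be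
    -- compensated in the V[1] component.
    obtain ⟨c₁, hc₁, b₁, hb₁, hxc₁, hsc₁⟩ := exists_boundary_lift_apply hs e₁_mul_e₁ e₁_mul_e₁
      (by lia : (0 - 1 - 1 : ℤ) + 1 = 0 - 1) (by lia : (0 - 1 : ℤ) + 1 = 0)
      (by lia : (0 : ℤ) + 1 = 1) (x₁ f) c₁' (x₁_mem f) h₁ (d_x₁ f 1) hx₁
    obtain ⟨c₂, hc₂, b₂, hb₂, hxc₂, hsc₂⟩ := exists_boundary_lift_apply hs e₂_mul_e₂ e₂_mul_e₂
      (by lia : (0 - 1 - 1 : ℤ) + 1 = 0 - 1) (by lia : (0 - 1 : ℤ) + 1 = 0)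
      (by lia : (0 : ℤ) + 1 = 1) (x₂ f) c₂' (x₂_mem f) h₂ (d_x₂ f 1) hx₂
    have hy' (i : ℤ) (w : idealV k deg (i + 1)) : s.1.f i (yV f i w) =
        N.cx.d (i - 1) i (Z' i w) +
          commutator (i + 1) (0 - 1) i (by lia) (by lia) (i + 1).negOnePow c₁' c₂' w := hy i w
    -- After the contribution of c₁ and c₂ is removed, what remains is a cycle. Its image bounds Z'
    -- minus the commutator of b₁ and b₂, whose sign 1 turns into the required one under d.
    have key (i : ℤ) := exists_boundary_lift hs e₂_mul_e₂ e₁_mul_e₁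
      (by lia : i - 1 - 1 + 1 = i - 1) (by lia : i - 1 + 1 = i) (rfl : i + 1 = i + 1)
      (yV f i - commutator (i + 1) (0 - 1) i (by lia) (by lia) (i + 1).negOnePow c₁ c₂)
      (Z' i - commutator (i + 1) (0 - 1 - 1) (i - 1) (by lia) (by lia) 1 b₁ b₂)
      (fun w => sub_mem (yV_mem f i w) (commutator_mem_corner _ _ _ _ _ _ hc₁ hc₂ w))
      (fun w => sub_mem (hZ' i w) (commutator_mem_corner _ _ _ _ _ _ hb₁ hb₂ w))
      (fun w => by
        rw [LinearMap.sub_apply, map_sub,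
          d_commutator (i + 1) (0 - 1) i 0 (i + 1) _ _ (by lia) (by lia) (by lia),
          Int.units_mul_self, ← hxc₁, ← hxc₂, d_yV, commutator_apply, one_smul, sub_self])
      (fun w => by
        rw [LinearMap.sub_apply, LinearMap.sub_apply, map_sub, map_sub, map_commutator, hsc₁,
          hsc₂, commutator_add, hy',
          d_commutator (i + 1) (0 - 1 - 1) (i - 1) (0 - 1) i _ _ (by lia) (by lia) (by lia),
          one_mul]
        abel)
    choose Z B hZ hB hdZ hZB using key
    refine ⟨c₁, hc₁, c₂, hc₂, Z, hZ, hxc₁, hxc₂, fun i w => ?_⟩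
    rw [← hdZ, ← sub_eq_iff_eq_add]
    rfl

end Kronecker

/-! ### Morphisms from the resolution to Λ[p] as scalars and matrices. -/

namespace Kronecker

open CochainComplex DGBimodule

variable (k : Type u) [Field k] {n : ℕ} (deg : Fin n → ℤ) (p : ℤ)

/-- The shift of the diagonal bimodule. -/
noncomputable abbrev shifted : DGBimodule (dgAlgebra k deg) :=
  (DGBimodule.regular (dgAlgebra k deg)).shift p

/-- The inclusion of the components of the shifted diagonal bimodule into the path algebra. -/
def shPath (i : ℤ) : (shifted k deg p).cx.X i →ₗ[k] PathAlgebra k n :=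
  toPath k deg (i + p)

variable {k deg p}

theorem shPath_injective (i : ℤ) : Function.Injective (shPath k deg p i) :=
  toPath_injective (i + p)

theorem shPath_lact {i j l : ℤ} (h : i + j = l) (a : (dgAlgebra k deg).cx.X i)
    (m : (shifted k deg p).cx.X j) :
    shPath k deg p l ((shifted k deg p).lact i j l h a m) =
      (p * i).negOnePow • pathMul k (toPath k deg i a) (shPath k deg p j m) :=
  map_units_smul (toPath k deg (l + p)) _ _

theorem shPath_ract {i j l : ℤ} (h : i + j = l) (m : (shifted k deg p).cx.X i)
    (a : (dgAlgebra k deg).cx.X j) :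
    shPath k deg p l ((shifted k deg p).ract i j l h m a) =
      pathMul k (shPath k deg p i m) (toPath k deg j a) := rfl

theorem shifted_d (i j : ℤ) (m : (shifted k deg p).cx.X i) : (shifted k deg p).cx.d i j m = 0 :=
  smul_zero (A := (dgAlgebra k deg).cx.X (j + p)) p.negOnePow

theorem shPath_fst {i : ℤ} (hi : i + p ≠ 0) (m : (shifted k deg p).cx.X i) :
    (shPath k deg p i m).1 = 0 :=
  toPath_fst_eq_zero hi m

theorem shPath_snd {i : ℤ} (m : (shifted k deg p).cx.X i) (α : Fin n) (hα : deg α ≠ i + p) :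
    (shPath k deg p i m).2 α = 0 :=
  (Subtype.prop (p := (· ∈ homogeneous k deg (i + p))) m).2 α hα

theorem mem_corner_iff {e e' : (dgAlgebra k deg).cx.X 0} {i : ℤ} {m : (shifted k deg p).cx.X i} :
    m ∈ corner (shifted k deg p) e e' i ↔
      pathMul k (toPath k deg 0 e) (shPath k deg p i m) = shPath k deg p i m ∧
      pathMul k (shPath k deg p i m) (toPath k deg 0 e') = shPath k deg p i m := by
  have h := shPath_lact (zero_add i) e m
  rw [mul_zero, Int.negOnePow_zero, one_smul] at h
  rw [← h, ← shPath_ract (add_zero i), (shPath_injective i).eq_iff, (shPath_injective i).eq_iff]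
  rfl

theorem mem_corner₁₁_iff {i : ℤ} {m : (shifted k deg p).cx.X i} :
    m ∈ corner (shifted k deg p) (e₁ k deg) (e₁ k deg) i ↔
      (shPath k deg p i m).1.2 = 0 ∧ (shPath k deg p i m).2 = 0 := by
  rw [mem_corner_iff, toPath_e₁, pathMul_apply, pathMul_apply]
  generalize shPath k deg p i m = x
  obtain ⟨⟨a, b⟩, v⟩ := x
  simp only [Prod.mk.injEq, funext_iff, Pi.zero_apply]
  grind

theorem mem_corner₂₂_iff {i : ℤ} {m : (shifted k deg p).cx.X i} :
    m ∈ corner (shifted k deg p) (e₂ k deg) (e₂ k deg) i ↔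
      (shPath k deg p i m).1.1 = 0 ∧ (shPath k deg p i m).2 = 0 := by
  rw [mem_corner_iff, toPath_e₂, pathMul_apply, pathMul_apply]
  generalize shPath k deg p i m = x
  obtain ⟨⟨a, b⟩, v⟩ := x
  simp only [Prod.mk.injEq, funext_iff, Pi.zero_apply]
  grind

theorem mem_corner₂₁_iff {i : ℤ} {m : (shifted k deg p).cx.X i} :
    m ∈ corner (shifted k deg p) (e₂ k deg) (e₁ k deg) i ↔ (shPath k deg p i m).1 = 0 := by
  rw [mem_corner_iff, toPath_e₁, toPath_e₂, pathMul_apply, pathMul_apply]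
  generalize shPath k deg p i m = x
  obtain ⟨⟨a, b⟩, v⟩ := x
  simp only [Prod.mk.injEq, Prod.mk_eq_zero, funext_iff, Pi.zero_apply]
  grind

/-- The arrow `β` as an element of `V`, in degree `i`, or `0` if the degree of `β` is not `i`. -/
noncomputable def arrow (i : ℤ) (β : Fin n) : idealV k deg i :=
  ⟨(⟨(0, if deg β = i then Pi.single β 1 else 0), fun _ => rfl, fun α hα => by
      split_ifs with h
      · exact Pi.single_eq_of_ne (by rintro rfl; exact hα h) _
      · rfl⟩ : homogeneous k deg i), rfl, rfl⟩

theorem toPath_arrow (i : ℤ) (β : Fin n) :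
    toPath k deg i (arrow (k := k) (deg := deg) i β) =
      (0, if deg β = i then Pi.single β 1 else 0) := rfl

theorem toPath_idealV {i : ℤ} (w : idealV k deg i) : (toPath k deg i w).1 = 0 :=
  Prod.ext w.2.2 w.2.1

/-- The sum may run over all arrows, since those of degree other than `i` contribute zero. -/
theorem eq_sum_arrow {i : ℤ} (w : idealV k deg i) :
    w = ∑ β, (toPath k deg i w).2 β • arrow i β := by
  refine Subtype.ext (toPath_injective i ?_)
  rw [Submodule.coe_sum, map_sum]
  simp only [Submodule.coe_smul, map_smul, toPath_arrow]
  refine Prod.ext ?_ (funext fun α => ?_)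
  · rw [toPath_idealV, Prod.fst_sum]
    simp
  · rw [Prod.snd_sum, Finset.sum_apply, Finset.sum_eq_single α]
    · by_cases h : deg α = i
      · simp [h]
      · rw [if_neg h]
        exact ((Subtype.prop (p := (· ∈ homogeneous k deg i)) w.1).2 α h).trans (mul_zero _).symm
    · intro β _ hβ
      split_ifs <;> simp [Pi.single_eq_of_ne (Ne.symm hβ)]
    · simp

variable (k deg p)

/-- The pairs of arrows indexing the matrix entries of the endomorphisms of `V` of degree
`p - 1`. -/
abbrev Pairs : Type := {q : Fin n × Fin n // deg q.1 - deg q.2 = p - 1}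

/-- The `e₁`-coefficient of the image of `e₁` under a morphism from the resolution to the shifted
diagonal bimodule. -/
noncomputable def scalarPart : (resolution k deg ⟶ shifted k deg p) →ₗ[k] k where
  toFun f := (shPath k deg p 0 (x₁ f)).1.1
  map_add' f g := congrArg (fun t => t.1.1) (map_add (shPath k deg p 0) (x₁ f) (x₁ g))
  map_smul' c f := congrArg (fun t => t.1.1) (map_smul (shPath k deg p 0) c (x₁ f))

/-- The matrix of the endomorphism of `V` given by a morphism from the resolution to the shifted
diagonal bimodule. -/
noncomputable def matrixPart :
    (resolution k deg ⟶ shifted k deg p) →ₗ[k] (Pairs deg p → k) where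
  -- An arrow β sits in degree deg β - 1 of V[1].
  toFun f q := (shPath k deg p (deg q.1.2 - 1) (yV f _ (arrow _ q.1.2))).2 q.1.1
  map_add' f g := funext fun q => congrArg (fun t => t.2 q.1.1)
    (map_add (shPath k deg p _) (yV f _ (arrow _ q.1.2)) (yV g _ (arrow _ q.1.2)))
  map_smul' c f := funext fun q => congrArg (fun t => t.2 q.1.1)
    (map_smul (shPath k deg p _) c (yV f _ (arrow _ q.1.2)))

variable {k deg p}

theorem scalarPart_eq_zero (hp : p ≠ 0) (f : resolution k deg ⟶ shifted k deg p) :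
    scalarPart k deg p f = 0 :=
  congrArg Prod.fst (shPath_fst (by lia : 0 + p ≠ 0) (x₁ f))

/-- For p = 0, the vanishing of d turns `d_yV` into w x₁ = x₂ w, and an arrow β compares the two
scalars. For p ≠ 0 both vanish for degree reasons. -/
theorem x₂_coeff (hn : 1 ≤ n) (f : resolution k deg ⟶ shifted k deg p) :
    (shPath k deg p 0 (x₂ f)).1.2 = scalarPart k deg p f := by
  by_cases hp : p = 0
  · subst hp
    let β : Fin n := ⟨0, hn⟩
    have h := d_yV f (deg β - 1) (arrow _ β)
    rw [shifted_d, eq_comm, sub_eq_zero] at h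
    have h' := congrArg (shPath k deg 0 _) h
    rw [shPath_lact, shPath_ract, toPath_arrow, if_pos (by lia), zero_mul, Int.negOnePow_zero,
      one_smul, pathMul_apply, pathMul_apply] at h'
    have := congrFun (congrArg Prod.snd h') β
    simp only [Pi.single_eq_same, one_mul, mul_one, Prod.fst_zero, Prod.snd_zero,
      zero_mul, mul_zero, add_zero, zero_add] at this
    exact this.symm
  · rw [scalarPart_eq_zero hp, shPath_fst (by lia)]
    rfl

/-- The values x₁ and x₂ share one scalar, and the entries of Y at pairs outside `Pairs deg p`
vanish by homogeneity. -/
theorem eq_zero_of_parts (hn : 1 ≤ n) (f : resolution k deg ⟶ shifted k deg p)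
    (h₁ : scalarPart k deg p f = 0) (h₂ : matrixPart k deg p f = 0) : f = 0 := by
  refine hom_ext_resolution ?_ ?_ fun i w => ?_
  · refine shPath_injective 0 (Eq.trans ?_ (map_zero _).symm)
    obtain ⟨h3, h4⟩ := mem_corner₁₁_iff.1 (x₁_mem f)
    exact Prod.ext (Prod.ext h₁ h3) h4
  · refine shPath_injective 0 (Eq.trans ?_ (map_zero _).symm)
    obtain ⟨h3, h4⟩ := mem_corner₂₂_iff.1 (x₂_mem f)
    exact Prod.ext (Prod.ext h3 ((x₂_coeff hn f).trans h₁)) h4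
  · change yV f i w = 0
    rw [eq_sum_arrow w, map_sum]
    refine Finset.sum_eq_zero fun β _ => ?_
    rw [map_smul]
    refine (congrArg _ ?_).trans (smul_zero _)
    by_cases hβ : deg β = i + 1
    · obtain rfl : i = deg β - 1 := by lia
      refine shPath_injective _ (Eq.trans ?_ (map_zero _).symm)
      refine Prod.ext (mem_corner₂₁_iff.1 (yV_mem f _ _)) (funext fun α => ?_)
      by_cases hα : deg α = deg β - 1 + p
      · exact congrFun h₂ ⟨(α, β), by lia⟩
      · exact shPath_snd _ _ hα
    · have : arrow (k := k) (deg := deg) (i + 1) β = 0 := by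
        refine Subtype.ext (toPath_injective _ ?_)
        rw [toPath_arrow, if_neg hβ]
        exact (map_zero _).symm
      rw [this, map_zero]

/-- The extension of a matrix by zero. -/
noncomputable def extendMatrix (S : Pairs deg p → k) : Matrix (Fin n) (Fin n) k := fun α β =>
  if h : deg α - deg β = p - 1 then S ⟨(α, β), h⟩ else 0

theorem extendMatrix_of_ne (S : Pairs deg p → k) {α β : Fin n} (h : deg α - deg β ≠ p - 1) :
    extendMatrix S α β = 0 := dif_neg h

/-- The endomorphism of `V` of degree `p - 1` with a given matrix. -/
noncomputable def matrixHom (S : Pairs deg p → k) (i : ℤ) :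
    idealV k deg (i + 1) →ₗ[k] (shifted k deg p).cx.X i :=
  LinearMap.codRestrict (homogeneous k deg (i + p))
    (LinearMap.inr k (k × k) (Fin n → k) ∘ₗ (extendMatrix S).mulVecLin ∘ₗ
      LinearMap.snd k (k × k) (Fin n → k) ∘ₗ toPath k deg (i + 1) ∘ₗ (idealV k deg (i + 1)).subtype)
    (fun w => ⟨fun _ => rfl, fun α hα => by
      refine Finset.sum_eq_zero (s := Finset.univ)
        (f := fun β => extendMatrix S α β * (toPath k deg (i + 1) w).2 β) fun β _ => ?_
      -- Off the target degree every term vanishes: either w has no β-coordinate or the matrix entry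
      -- is zero.
      by_cases hβ : deg β = i + 1
      · rw [extendMatrix_of_ne S (by lia), zero_mul]
      · have : (toPath k deg (i + 1) w).2 β = 0 :=
          (Subtype.prop (p := (· ∈ homogeneous k deg (i + 1))) w.1).2 β hβ
        exact (congrArg _ this).trans (mul_zero _)⟩)

theorem shPath_matrixHom (S : Pairs deg p → k) (i : ℤ) (w : idealV k deg (i + 1)) :
    shPath k deg p i (matrixHom S i w) =
      (0, (extendMatrix S).mulVec (toPath k deg (i + 1) w).2) := rfl

/-- The proposition `q` replaces the equality of degrees by a simpler equivalent, such as p = 0. -/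
theorem toPath_castX (i j : ℤ) {q : Prop} [Decidable q] (h : i = j ↔ q)
    (x : (dgAlgebra k deg).cx.X i) :
    toPath k deg j (castX (dgAlgebra k deg).cx i j x) = if q then toPath k deg i x else 0 := by
  split_ifs with hq
  · obtain rfl := h.2 hq
    rw [castX_self]
  · rw [castX_of_ne _ (mt h.1 hq), map_zero]

theorem shPath_castX (x : (dgAlgebra k deg).cx.X 0) :
    shPath k deg p 0 (castX (dgAlgebra k deg).cx 0 (0 + p) x) =
      if p = 0 then toPath k deg 0 x else 0 :=
  toPath_castX 0 (0 + p) (by lia) x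

/-- The values c e₁, c e₂ and S satisfy the relation since w (c e₁) = (c e₂) w. For p ≠ 0 the
`castX` kills the first two, so c is recovered only for p = 0. -/
theorem exists_hom (c : k) (S : Pairs deg p → k) :
    ∃ f : resolution k deg ⟶ shifted k deg p,
      (p = 0 → scalarPart k deg p f = c) ∧ matrixPart k deg p f = S := by
  let a : (shifted k deg p).cx.X 0 := castX (dgAlgebra k deg).cx 0 (0 + p) (c • e₁ k deg)
  let b : (shifted k deg p).cx.X 0 := castX (dgAlgebra k deg).cx 0 (0 + p) (c • e₂ k deg)
  have hpa : shPath k deg p 0 a = if p = 0 then c • ((1, 0), 0) else 0 := shPath_castX _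
  have hpb : shPath k deg p 0 b = if p = 0 then c • ((0, 1), 0) else 0 := shPath_castX _
  have ha : a ∈ corner (shifted k deg p) (e₁ k deg) (e₁ k deg) 0 := by
    rw [mem_corner₁₁_iff, hpa]
    split_ifs <;> simp
  have hb : b ∈ corner (shifted k deg p) (e₂ k deg) (e₂ k deg) 0 := by
    rw [mem_corner₂₂_iff, hpb]
    split_ifs <;> simp
  have hY (i : ℤ) (w : idealV k deg (i + 1)) :
      matrixHom S i w ∈ corner (shifted k deg p) (e₂ k deg) (e₁ k deg) i := by
    rw [mem_corner₂₁_iff, shPath_matrixHom]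
  have hdY (i : ℤ) (w : idealV k deg (i + 1)) :
      (shifted k deg p).cx.d i (i + 1) (matrixHom S i w) =
        (shifted k deg p).lact (i + 1) 0 (i + 1) (add_zero _) w a -
          (shifted k deg p).ract 0 (i + 1) (i + 1) (zero_add _) b w := by
    rw [shifted_d, eq_comm, sub_eq_zero]
    refine shPath_injective _ ?_
    rw [shPath_lact, shPath_ract, hpa, hpb]
    by_cases hp : p = 0
    · rw [if_pos hp, if_pos hp, hp, zero_mul, Int.negOnePow_zero, one_smul, pathMul_apply,
        pathMul_apply, toPath_idealV]
      ext <;> simp [mul_comm]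
    · rw [if_neg hp, if_neg hp, map_zero, smul_zero, LinearMap.map_zero₂]
  refine ⟨homMk a b (matrixHom S) ha hb hY (shifted_d _ _ _) (shifted_d _ _ _) hdY, fun hp => ?_,
    funext fun q => ?_⟩
  · change (shPath k deg p 0 (x₁ (homMk a b (matrixHom S) ha hb hY (shifted_d _ _ _)
      (shifted_d _ _ _) hdY))).1.1 = c
    rw [x₁_homMk, hpa, if_pos hp]
    simp
  · change (shPath k deg p _ (yV (homMk a b (matrixHom S) ha hb hY (shifted_d _ _ _)
      (shifted_d _ _ _) hdY) _ (arrow _ q.1.2))).2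
      q.1.1 = S q
    rw [yV_homMk, shPath_matrixHom, toPath_arrow, if_pos (by lia)]
    simp only [Matrix.mulVec_single_one]
    exact dif_pos q.2

theorem corner₁₁_eq_zero {i : ℤ} {m : (shifted k deg p).cx.X i}
    (hm : m ∈ corner (shifted k deg p) (e₁ k deg) (e₁ k deg) i) (hi : i + p ≠ 0) : m = 0 :=
  shPath_injective i ((Prod.ext (shPath_fst hi m) (mem_corner₁₁_iff.1 hm).2).trans
    (map_zero _).symm)

theorem corner₂₂_eq_zero {i : ℤ} {m : (shifted k deg p).cx.X i}
    (hm : m ∈ corner (shifted k deg p) (e₂ k deg) (e₂ k deg) i) (hi : i + p ≠ 0) : m = 0 :=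
  shPath_injective i ((Prod.ext (shPath_fst hi m) (mem_corner₂₂_iff.1 hm).2).trans
    (map_zero _).symm)

/-- The elements c₁, c₂ are multiples of e₁, e₂ lying in degree p - 1 of Λ, hence zero; Z
contributes only through d = 0. -/
theorem eq_zero_of_mem_nullHomotopic (hp : p ≠ 1) (f : resolution k deg ⟶ shifted k deg p)
    (hf : f ∈ nullHomotopic (resolution k deg) (shifted k deg p)) : f = 0 := by
  obtain ⟨c₁, h₁, c₂, h₂, Z, hZ, hx₁, hx₂, hy⟩ := (mem_nullHomotopic_iff f).1 hf
  refine hom_ext_resolution (hx₁.trans (shifted_d _ _ _)) (hx₂.trans (shifted_d _ _ _))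
    fun i w => (hy i w).trans ?_
  rw [corner₁₁_eq_zero h₁ (by lia), corner₂₂_eq_zero h₂ (by lia), shifted_d, map_zero,
    LinearMap.map_zero₂, smul_zero, sub_zero, add_zero]
  rfl

variable (k deg) in
/-- The matrix of the identity of `V`. -/
def diagonal : Pairs deg 1 → k := fun q => if q.1.1 = q.1.2 then 1 else 0

/-- The sign of the homotopy formula cancels the sign of the left action on Λ[1], leaving
multiplication of w by a scalar. -/
theorem matrixPart_of_commutator (f : resolution k deg ⟶ shifted k deg 1)
    (c₁ c₂ : (shifted k deg 1).cx.X (0 - 1))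
    (hf : ∀ i w, yV f i w =
      commutator (i + 1) (0 - 1) i (by lia) (by lia) (i + 1).negOnePow c₁ c₂ w) :
    matrixPart k deg 1 f =
      ((shPath k deg 1 _ c₁).1.1 - (shPath k deg 1 _ c₂).1.2) • diagonal k deg := by
  funext q
  change (shPath k deg 1 _ (yV f _ (arrow _ q.1.2))).2 q.1.1 = _
  rw [hf, commutator_apply, map_sub, map_units_smul, shPath_lact, shPath_ract, one_mul, smul_smul,
    Int.units_mul_self, one_smul, pathMul_apply, pathMul_apply, toPath_arrow, if_pos (by lia)]
  simp only [diagonal, Prod.snd_sub, Pi.sub_apply, Pi.smul_apply, Pi.single_apply, smul_eq_mul]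
  split_ifs <;> simp

/-- Only c₁ and c₂ contribute to a null-homotopic morphism, and what they give is a multiple of the
identity of V. -/
theorem mem_nullHomotopic_one_iff (hn : 1 ≤ n) (f : resolution k deg ⟶ shifted k deg 1) :
    f ∈ nullHomotopic (resolution k deg) (shifted k deg 1) ↔
      matrixPart k deg 1 f ∈ Submodule.span k {diagonal k deg} := by
  rw [Submodule.mem_span_singleton]
  constructor
  · intro hf
    obtain ⟨c₁, -, c₂, -, Z, -, -, -, hy⟩ := (mem_nullHomotopic_iff f).1 hf
    refine ⟨_, (matrixPart_of_commutator f c₁ c₂ fun i w => (hy i w).trans ?_).symm⟩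
    rw [shifted_d, zero_add, commutator_apply]
  · rintro ⟨c, hc⟩
    -- Only the difference of the scalars of c₁ and c₂ matters, so c₁ = c e₁ and c₂ = 0 suffice.
    let a : (shifted k deg 1).cx.X (0 - 1) :=
      castX (dgAlgebra k deg).cx 0 (0 - 1 + 1) (c • e₁ k deg)
    have hpa : shPath k deg 1 (0 - 1) a = c • ((1, 0), 0) :=
      (toPath_castX 0 (0 - 1 + 1) (q := True) (by lia) _).trans (if_pos trivial)
    have ha : a ∈ corner (shifted k deg 1) (e₁ k deg) (e₁ k deg) (0 - 1) := by
      rw [mem_corner₁₁_iff, hpa]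
      simp
    have hY (i : ℤ) (w : idealV k deg (i + 1)) := commutator_mem_corner (i + 1) (0 - 1) i
      (by lia) (by lia) (i + 1).negOnePow ha (zero_mem (corner (shifted k deg 1) _ _ _)) w
    have hdY (i : ℤ) (w : idealV k deg (i + 1)) : (shifted k deg 1).cx.d i (i + 1)
        (commutator (i + 1) (0 - 1) i (by lia) (by lia) (i + 1).negOnePow a 0 w) =
        (shifted k deg 1).lact (i + 1) 0 (i + 1) (add_zero _) w 0 -
          (shifted k deg 1).ract 0 (i + 1) (i + 1) (zero_add _) 0 w := by
      rw [shifted_d, map_zero, LinearMap.map_zero₂, sub_zero]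
    have hg := yV_homMk (zero_mem _) (zero_mem _) hY (shifted_d _ _ _) (shifted_d _ _ _) hdY
    have hg₁ := x₁_homMk (zero_mem _) (zero_mem _) hY (shifted_d _ _ _) (shifted_d _ _ _) hdY
    have hg₂ := x₂_homMk (zero_mem _) (zero_mem _) hY (shifted_d _ _ _) (shifted_d _ _ _) hdY
    generalize homMk 0 0 _ (zero_mem _) (zero_mem _) hY (shifted_d _ _ _) (shifted_d _ _ _) hdY = g
      at hg hg₁ hg₂
    -- For p = 1 the scalar part is zero, so equality of matrices is equality of morphisms.
    have hfg : f = g := by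
      rw [← sub_eq_zero]
      refine eq_zero_of_parts hn _ (scalarPart_eq_zero one_ne_zero _) ?_
      rw [map_sub, matrixPart_of_commutator g a 0 hg, hpa, ← hc, map_zero]
      simp
    rw [hfg, mem_nullHomotopic_iff]
    refine ⟨a, ha, 0, zero_mem _, 0, fun i w => zero_mem _, hg₁.trans (shifted_d _ _ _).symm,
      hg₂.trans (shifted_d _ _ _).symm, fun i w => (hg i w).trans ?_⟩
    rw [shifted_d, zero_add, commutator_apply]

/-- With at least one arrow the identity of V is nonzero, so exactly one dimension is lost for p =
1. -/
theorem diagonal_ne_zero (hn : 1 ≤ n) : diagonal k deg ≠ 0 := fun h => by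
  have := congrFun h ⟨(⟨0, hn⟩, ⟨0, hn⟩), by simp⟩
  simp [diagonal] at this

/-! ### Hochschild cohomology and its dimension. -/

variable (k deg p)

/-- Hochschild cohomology is computed by the resolution. -/
noncomputable def hochschildEquiv :
    ((resolution k deg ⟶ shifted k deg p) ⧸
      nullHomotopic (resolution k deg) (shifted k deg p)) ≃ₗ[k] (dgAlgebra k deg).HH p :=
  (isHProjective_resolution.homEquiv _).trans
    -- The augmentation becomes invertible, which replaces the source P by Λ.
    (haveI : IsIso ((quasiIso (dgAlgebra k deg)).Q.map (augmentation k deg)) :=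
      Localization.inverts _ _ _ (quasiIso_augmentation k deg)
    Linear.homCongr k (asIso ((quasiIso (dgAlgebra k deg)).Q.map (augmentation k deg)))
      (Iso.refl _))

variable {k deg p}

theorem matrixPart_bijective (hn : 1 ≤ n) (hp : p ≠ 0) :
    Function.Bijective (matrixPart k deg p) := by
  refine ⟨(injective_iff_map_eq_zero _).2 fun f hf =>
    eq_zero_of_parts hn f (scalarPart_eq_zero hp f) hf, fun S => ?_⟩
  obtain ⟨f, -, hf⟩ := exists_hom 0 S
  exact ⟨f, hf⟩

theorem scalarPart_prod_matrixPart_bijective (hn : 1 ≤ n) :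
    Function.Bijective ((scalarPart k deg 0).prod (matrixPart k deg 0)) := by
  refine ⟨(injective_iff_map_eq_zero _).2 fun f hf =>
    eq_zero_of_parts hn f (congrArg Prod.fst hf) (congrArg Prod.snd hf), fun S => ?_⟩
  obtain ⟨f, hf₁, hf₂⟩ := exists_hom S.1 S.2
  exact ⟨f, Prod.ext (hf₁ rfl) hf₂⟩

/-- If there are no null-homotopic morphisms, Hochschild cohomology is a space of morphisms. -/
noncomputable def hochschildEquivHom (hp : p ≠ 1) :
    (resolution k deg ⟶ shifted k deg p) ≃ₗ[k] (dgAlgebra k deg).HH p :=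
  (Submodule.quotEquivOfEqBot _ ((Submodule.eq_bot_iff _).2 fun f hf =>
    eq_zero_of_mem_nullHomotopic hp f hf)).symm.trans (hochschildEquiv k deg p)

variable (k deg) in
/-- In degree `1`, Hochschild cohomology is a quotient of the space of degree `0` endomorphisms
of `V`. -/
noncomputable def hochschildEquivOne (hn : 1 ≤ n) :
    ((Pairs deg 1 → k) ⧸ Submodule.span k {diagonal k deg}) ≃ₗ[k] (dgAlgebra k deg).HH 1 :=
  (Submodule.Quotient.equiv _ _
    (LinearEquiv.ofBijective _ (matrixPart_bijective hn one_ne_zero)) (by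
      ext S
      rw [Submodule.mem_map]
      constructor
      · rintro ⟨f, hf, rfl⟩
        exact (mem_nullHomotopic_one_iff hn f).1 hf
      · intro hS
        obtain ⟨f, rfl⟩ := (matrixPart_bijective hn one_ne_zero).2 S
        exact ⟨f, (mem_nullHomotopic_one_iff hn f).2 hS, rfl⟩)).symm.trans
    (hochschildEquiv k deg 1)

end Kronecker

theorem mainTheorem3 {k : Type u} [Field k] (n : ℕ) (hn : 1 ≤ n) (deg : Fin n → ℤ) (p : ℤ) :
    Module.Finite k ((Kronecker.dgAlgebra k deg).HH p) ∧
      (Module.finrank k ((Kronecker.dgAlgebra k deg).HH p) : ℤ) =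
        if p = 1 then
          (Nat.card {q : Fin n × Fin n // deg q.1 - deg q.2 = 0} : ℤ) - 1
        else if p = 0 then
          (Nat.card {q : Fin n × Fin n // deg q.1 - deg q.2 = -1} : ℤ) + 1
        else
          (Nat.card {q : Fin n × Fin n // deg q.1 - deg q.2 = p - 1} : ℤ) := by
  split_ifs with h1 h0
  · subst h1
    let e := Kronecker.hochschildEquivOne k deg hn
    refine ⟨Module.Finite.equiv e, ?_⟩
    -- The term -1 is the dimension of the line of scalar matrices.
    have h := Submodule.finrank_quotient_add_finrank (Submodule.span k {Kronecker.diagonal k deg})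
    rw [finrank_span_singleton (Kronecker.diagonal_ne_zero hn), e.finrank_eq,
      Module.finrank_fintype_fun_eq_card, ← Nat.card_eq_fintype_card] at h
    exact eq_sub_of_add_eq (by exact_mod_cast h)
  · subst h0
    let e := (LinearEquiv.ofBijective _ (Kronecker.scalarPart_prod_matrixPart_bijective
      (k := k) (deg := deg) hn)).symm.trans (Kronecker.hochschildEquivHom h1)
    refine ⟨Module.Finite.equiv e, ?_⟩
    -- The term +1 is the dimension of the scalar part.
    rw [← e.finrank_eq, Module.finrank_prod, Module.finrank_self,
      Module.finrank_fintype_fun_eq_card, ← Nat.card_eq_fintype_card, add_comm]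
    norm_num [Kronecker.Pairs]
  · let e := (LinearEquiv.ofBijective _ (Kronecker.matrixPart_bijective
      (k := k) (deg := deg) hn h0)).symm.trans (Kronecker.hochschildEquivHom h1)
    refine ⟨Module.Finite.equiv e, ?_⟩
    rw [← e.finrank_eq, Module.finrank_fintype_fun_eq_card, ← Nat.card_eq_fintype_card]
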